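/- Let $F$ be a $p$-adic field (a finite extension of some $\mathbb{Q}_p$), let $H\subseteq G$ be reductive $F$-groups such that $Y=H\backslash G$ is spherical, and let $y_0\in Y(F)$ be the base point. Fix a Haar measure on $G(F)$ with rational volumes on open compact subgroups, and a $G(F)$-invariant positive Radon measure on $Y(F)$. For a field $k$ let $\mathcal{S}(G(F),k)$ be the space of compactly supported functions $G(F)\to k$ that are bi-invariant under some open subgroup. **Local periods.** Fix a Plancherel decomposition of $L^2(Y(F))$, such as the one provided by the local conjecture of Sakellaridis and Venkatesh: a measure $\mu$ on a set of pairwise inequivalent irreducible unitary smooth admissible representations $\sigma$ of $G(F)$ (these are the representations that *appear in* $L^2(Y(F))$), together with non-zero $G(F)\times G(F)$-equivariant maps $M_\sigma:\sigma\otimes\sigma^\vee\to C^\infty(Y(F)\times Y(F))$ such that the forms $$J_\sigma(\Phi_1,\Phi_2)=\sum_j\iint \Phi_1(y_2)\overline{\Phi_2(y_1)}\,M_\sigma(\varphi_j,\varphi^j)(y_1,y_2)\,dy_1dy_2$$ on $C_c^\infty(Y(F))$ (where $\varphi_j,\varphi^j$ are dual bases of $\sigma^K$ and $(\sigma^\vee)^K$,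 and $K$ is an open compact subgroup fixing $\Phi_1,\Phi_2$) are positive semi-definite and $\langle\Phi_1,\Phi_2\rangle_{L^2}=\int J_\sigma(\Phi_1,\Phi_2)\,d\mu(\sigma)$. The local period of $\sigma$ is $Z_\sigma(v,w)=M_\sigma(v,w)(y_0,y_0)$ on $\sigma\times\sigma^\vee$; if $\sigma'$ is a smooth representation with a non-degenerate invariant pairing $\sigma\times\sigma'\to\mathbb{C}$, then $Z_\sigma$ is transported to $\sigma\times\sigma'$ through this pairing. The spherical character of $\sigma$ is $J_\sigma(f)=\sum_i Z_\sigma(\sigma(f)\varphi_i,\varphi^i)$ for $f\in\mathcal{S}(G(F),\mathbb{C})$ bi-$K$-invariant, where $\varphi_i,\varphi^i$ are dual bases of $\sigma^K$ and $(\sigma^\vee)^K$. **Families.** Let $E$ be a field embeddable into $\mathbb{C}$, $R$ a reduced Noetherian $E$-algebra, and $\Sigma\subseteq\mathrm{Spec}\,R$ a Zariski dense set of closed points. Let $\pi$ be a finitely generated smooth admissible torsion-free $R[G(F)]$-module, put $\pi|_x=\pi\otimes_R k(x)$, and let $\mathcal{E}(\pi|_x)$ be the set of field embeddings $\tau:k(x)\to\mathbb{C}$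 such that $(\pi|_x)_\tau=\pi|_x\otimes_{k(x),\tau}\mathbb{C}$ is irreducible and appears in $L^2(Y(F))$. Assume that $\mathcal{E}(\pi|_x)\neq\emptyset$ for all $x\in\Sigma$. A *dual family* of $\pi$ is a finitely generated smooth admissible torsion-free $R[G(F)]$-module $\tilde\pi$ with a $G(F)$-invariant $R$-bilinear pairing $(\cdot,\cdot):\pi\times\tilde\pi\to R$ whose specialization $\pi|_x\times\tilde\pi|_x\to k(x)$ is non-degenerate for every $x\in\Sigma$. * (P-rat) for every dual family $\tilde\pi$ and every $x\in\Sigma$ there is a unique bi-$H(F)$-invariant pairing $Z_{\pi|_x}:\pi|_x\times\tilde\pi|_x\to k(x)$ such that for all $\tau\in\mathcal{E}(\pi|_x)$ one has $\tau\circ Z_{\pi|_x}=Z_{(\pi|_x)_\tau}$ on $\pi|_x\times\tilde\pi|_x$, where $Z_{(\pi|_x)_\tau}$ is taken with respect to the linear extension of the pairing. * (P-mer), for a given dual family $\tilde\pi$: there are an open subset $U\supseteq\Sigma$ of $\mathrm{Spec}\,R$ and a bi-$H(F)$-invariant $R$-bilinear pairing $Z_\pi:\pi\times\tilde\pi\to\mathcal{O}(U)$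 that specializes at every $x\in\Sigma$ to a pairing $Z_{\pi|_x}$ as in (P-rat). * (C-rat) for every $x\in\Sigma$ there is a unique linear form $J_{\pi|_x}:\mathcal{S}(G(F),k(x))\to k(x)$ such that $\tau(J_{\pi|_x}(f))=J_{(\pi|_x)_\tau}(\tau\circ f)$ for all $\tau\in\mathcal{E}(\pi|_x)$ and all $f$. * (C-mer) such $J_{\pi|_x}$ exist for all $x\in\Sigma$, and for every $f\in\mathcal{S}(G(F),E)$ there is a unique meromorphic function $J_\pi(f)\in\mathrm{Frac}\,R$ (the total ring of fractions) that is regular at every $x\in\Sigma$ with value $J_{\pi|_x}(f)$. **Proposition.** (1) If $R=E$, then (P-rat) for $\pi$ implies (C-rat) for $\pi$. (2) For general $R$, let $\tilde\pi$ be a dual family of $\pi$ and suppose that for every open compact subgroup $K\subseteq G(F)$ the function $x\mapsto\dim_{k(x)}(\pi^K|_x)$ is locally constant on $\Sigma$. Then (P-mer) for $(\pi,\tilde\pi)$ implies (C-mer) for $\pi$. -/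

import Mathlib

open MeasureTheory TopologicalSpace
open scoped TensorProduct Matrix RightActions

universe u w

noncomputable section

/-! ## Smooth representations of topological groups -/

section Smooth

variable {G : Type*} [Group G] [TopologicalSpace G]

/-- Open compact subgroups. -/
def IsCompactOpen (K : Subgroup G) : Prop :=
  IsOpen (K : Set G) ∧ IsCompact (K : Set G)

variable {A : Type*} [CommRing A] {V W : Type*} [AddCommMonoid V] [Module A V]
  [AddCommMonoid W] [Module A W]

/-- The submodule `V^K` of `K`-fixed vectors. -/
def fixedVectors (ρ : Representation A G V) (K : Subgroup G) : Submodule A V where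
  carrier := {v | ∀ k ∈ K, ρ k v = v}
  zero_mem' := fun k _ => map_zero (ρ k)
  add_mem' := fun ha hb k hk => by rw [map_add, ha k hk, hb k hk]
  smul_mem' := fun c v hv k hk => by rw [map_smul, hv k hk]

/-- Every vector is fixed by some open compact subgroup. -/
def IsSmoothRep (ρ : Representation A G V) : Prop :=
  ∀ v : V, ∃ K : Subgroup G, IsCompactOpen K ∧ v ∈ fixedVectors ρ K

/-- The `K`-fixed vectors are finitely generated for every open compact subgroup `K`. -/
def IsAdmissibleRep (ρ : Representation A G V) : Prop :=
  ∀ K : Subgroup G, IsCompactOpen K → Module.Finite A (fixedVectors ρ K)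

/-- Finitely generated smooth admissible torsion-free `A[G]`-modules. -/
structure IsAdmissibleFamily (ρ : Representation A G V) : Prop where
  smooth : IsSmoothRep ρ
  admissible : IsAdmissibleRep ρ
  finitelyGenerated : Module.Finite (MonoidAlgebra A G) ρ.asModule
  torsionFree : Module.IsTorsionFree A V

/-- `G`-invariance of a bilinear pairing. -/
def IsInvariantPairing (ρ : Representation A G V) (ρ' : Representation A G W)
    (B : V →ₗ[A] W →ₗ[A] A) : Prop :=
  ∀ g v w, B (ρ g v) (ρ' g w) = B v w

/-- Bi-`H`-invariance of a bilinear pairing with values in a module. -/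
def IsBiInvariantPairing {P : Type*} [AddCommMonoid P] [Module A P] (H : Subgroup G)
    (ρ : Representation A G V) (ρ' : Representation A G W)
    (Z : V →ₗ[A] W →ₗ[A] P) : Prop :=
  ∀ h₁ ∈ H, ∀ h₂ ∈ H, ∀ v w, Z (ρ h₁ v) (ρ' h₂ w) = Z v w

/-- The space of the smooth contragredient `V^∨`: the linear forms on `V` that are fixed by an open
subgroup of `G`. -/
def contragredient [ContinuousMul G] (ρ : Representation A G V) :
    Submodule A (Module.Dual A V) where
  carrier := {l | ∃ U : Subgroup G, IsOpen (U : Set G) ∧ l ∈ fixedVectors ρ.dual U}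
  zero_mem' := ⟨⊤, isOpen_univ, Submodule.zero_mem _⟩
  add_mem' := by
    rintro a b ⟨K, hK, ha⟩ ⟨L, hL, hb⟩
    exact ⟨K ⊓ L, hK.inter hL,
      Submodule.add_mem _ (fun k hk => ha k hk.1) (fun k hk => hb k hk.2)⟩
  smul_mem' := by
    rintro c a ⟨K, hK, ha⟩
    exact ⟨K, hK, Submodule.smul_mem _ c ha⟩

theorem contragredient_stable [ContinuousMul G] (ρ : Representation A G V) (g : G)
    (l : Module.Dual A V) (hl : l ∈ contragredient ρ) : ρ.dual g l ∈ contragredient ρ := by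
  obtain ⟨U, hU, hl⟩ := hl
  refine ⟨U.comap (MulAut.conj g⁻¹).toMonoidHom, ?_, ?_⟩
  · have : Continuous fun x : G => g⁻¹ * x * g :=
      (continuous_const.mul continuous_id).mul continuous_const
    have h2 := hU.preimage this
    convert h2 using 1
    ext x
    simp
  · intro k hk
    have hk' : g⁻¹ * k * g ∈ U := by simpa using hk
    have h1 := hl _ hk'
    calc ρ.dual k (ρ.dual g l) = ρ.dual g (ρ.dual (g⁻¹ * k * g) l) := by
          rw [← Module.End.mul_apply, ← Module.End.mul_apply, ← map_mul, ← map_mul]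
          congr 2
          group
      _ = ρ.dual g l := by rw [h1]

/-- The action of `G` on the smooth contragredient. -/
def contragredientRep [ContinuousMul G] (ρ : Representation A G V) :
    Representation A G (contragredient ρ) where
  toFun g := (ρ.dual g).restrict (fun l hl => contragredient_stable ρ g l hl)
  map_one' := by
    ext l v
    simp [Representation.dual_apply, Module.Dual.transpose_apply]
  map_mul' g h := by
    ext l v
    simp [Representation.dual_apply, Module.Dual.transpose_apply]

/-- Bases of `V^K` and of `(V^∨)^K` that are dual to each other. -/
structure DualBases [ContinuousMul G] (ρ : Representation A G V) (K : Subgroup G) where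
  rank : ℕ
  basis : Module.Basis (Fin rank) A (fixedVectors ρ K)
  dualBasis : Module.Basis (Fin rank) A (fixedVectors (contragredientRep ρ) K)
  pairing : ∀ i j,
    (((dualBasis j : contragredient ρ) : Module.Dual A V) (basis i : V)) = if i = j then 1 else 0

/-- Bi-`K`-invariant functions. -/
def IsBiInvariant {k : Type*} (K : Subgroup G) (f : G → k) : Prop :=
  ∀ a ∈ K, ∀ b ∈ K, ∀ g, f (a * g * b) = f g

/-- The Hecke algebra `S(G, k)` of compactly supported functions `G → k` that are bi-invariant under
some open subgroup (as a `k`-module). -/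
def heckeSpace (G : Type*) [Group G] [TopologicalSpace G] (k : Type*) [CommRing k] :
    Submodule k (G → k) where
  carrier := {f | HasCompactSupport f ∧ ∃ U : Subgroup G, IsOpen (U : Set G) ∧ IsBiInvariant U f}
  zero_mem' := ⟨HasCompactSupport.zero, ⊤, isOpen_univ, fun _ _ _ _ _ => rfl⟩
  add_mem' := by
    rintro f f' ⟨hf, U, hU, hfU⟩ ⟨hf', U', hU', hfU'⟩
    refine ⟨hf.add hf', U ⊓ U', hU.inter hU', fun a ha b hb g => ?_⟩
    simp only [Pi.add_apply]
    rw [hfU a ha.1 b hb.1, hfU' a ha.2 b hb.2]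
  smul_mem' := by
    rintro c f ⟨hf, U, hU, hfU⟩
    refine ⟨hf.mono fun x hx hfx => hx (by simp [hfx]), U, hU, fun a ha b hb g => ?_⟩
    simp only [Pi.smul_apply]
    rw [hfU a ha b hb]

/-- Change of coefficients `S(G, k) → S(G, k')` along a ring homomorphism. -/
def heckeSpace.map {k k' : Type*} [CommRing k] [CommRing k'] (φ : k →+* k') (f : heckeSpace G k) :
    heckeSpace G k' :=
  ⟨fun g => φ (f.1 g), f.2.1.comp_left (map_zero φ), by
    obtain ⟨U, hU, h⟩ := f.2.2
    exact ⟨U, hU, fun a ha b hb g => congrArg φ (h a ha b hb g)⟩⟩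

/-- The Haar measure takes rational values on open compact subgroups. -/
def IsRationalMeasure [MeasurableSpace G] (μ : Measure G) : Prop :=
  ∀ K : Subgroup G, IsCompactOpen K → ∃ q : ℚ, (q : ℝ) = μ.real K

end Smooth

section Complex

variable {G : Type*} [Group G] [TopologicalSpace G] [MeasurableSpace G]
variable {V : Type*} [AddCommGroup V] [Module ℂ V]

/-- `σ(f) v = ∫ f(g) σ(g) v dg`, for a vector `v` fixed by the open compact subgroup `K` and a
compactly supported function `f` invariant under right translation by `K`, in which case the
integral is the finite sum over `G / K` written here. -/
def heckeAction (μ : Measure G) (σ : Representation ℂ G V) (K : Subgroup G) (f : G → ℂ) (v : V) :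
    V :=
  (μ.real K : ℂ) • ∑ᶠ q : G ⧸ K, f q.out • σ q.out v

open Classical in
/-- The spherical character `J(f) = ∑ᵢ Z(σ(f) φᵢ, φⁱ)` attached to a pairing `Z : σ × σ^∨ → ℂ`,
where `f` is bi-`K`-invariant and `φᵢ`, `φⁱ` are dual bases of `σ^K` and `(σ^∨)^K`. For an admissible
smooth `σ` and `f ∈ S(G, ℂ)` such choices exist and the sum does not depend on them. -/
def sphericalCharacter [ContinuousMul G] (μ : Measure G) (σ : Representation ℂ G V)
    (Z : V →ₗ[ℂ] contragredient σ →ₗ[ℂ] ℂ) (f : heckeSpace G ℂ) : ℂ :=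
  if h : ∃ K : Subgroup G, IsCompactOpen K ∧ IsBiInvariant K f.1 ∧ Nonempty (DualBases σ K) then
    let b : DualBases σ h.choose := h.choose_spec.2.2.some
    ∑ i, Z (heckeAction μ σ h.choose f.1 (b.basis i)) (b.dualBasis i)
  else 0

/-- A representation is unitary if it has an invariant positive definite Hermitian form. -/
def IsUnitaryRep (σ : Representation ℂ G V) : Prop :=
  ∃ h : V →ₗ⋆[ℂ] V →ₗ[ℂ] ℂ, (∀ v w, h w v = star (h v w)) ∧
    (∀ v, v ≠ 0 → 0 < (h v v).re) ∧ ∀ g v w, h (σ g v) (σ g w) = h v w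

/-- Locally constant compactly supported functions. -/
def IsTestFunction {Y : Type*} [TopologicalSpace Y] (Φ : Y → ℂ) : Prop :=
  IsLocallyConstant Φ ∧ HasCompactSupport Φ

end Complex

/-! ## Plancherel decompositions and local periods -/

/-- A Plancherel decomposition of `L²(Y, ν)`, for a right `G`-space `Y` with an invariant measure
`ν`. It consists of a measure `μ` on a set `ι` of pairwise inequivalent irreducible unitary smooth
admissible representations `σ i`, and for every `i` of a `G × G`-equivariant map
`coeff i : σ i ⊗ (σ i)^∨ → C^∞(Y × Y)`. The latter is dual to a map
`C_c^∞(Y × Y) → σ i ⊗ (σ i)^∨`, which defines the `σ i`-isotypic form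
`form i Φ₁ Φ₂ = ∑ⱼ ∫∫ Φ₁(y₂) conj(Φ₂(y₁)) coeff i φⱼ φʲ (y₁, y₂)`
on `C_c^∞(Y)`. It is required to be positive and the inner product of `L²(Y, ν)` is required to be
the integral of these forms. -/
structure PlancherelDecomposition (G : Type*) [Group G] [TopologicalSpace G] [ContinuousMul G]
    {Y : Type*} [TopologicalSpace Y] [MeasurableSpace Y] [MulAction Gᵐᵒᵖ Y] (ν : Measure Y) where
  ι : Type w
  [measurableSpace : MeasurableSpace ι]
  μ : Measure ι
  V : ι → Type w
  [addCommGroup : ∀ i, AddCommGroup (V i)]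
  [module : ∀ i, Module ℂ (V i)]
  σ : ∀ i, Representation ℂ G (V i)
  irreducible : ∀ i, (σ i).IsIrreducible
  smooth : ∀ i, IsSmoothRep (σ i)
  admissible : ∀ i, IsAdmissibleRep (σ i)
  unitary : ∀ i, IsUnitaryRep (σ i)
  inequivalent : ∀ i j, i ≠ j → IsEmpty ((σ i).Equiv (σ j))
  coeff : ∀ i, V i →ₗ[ℂ] contragredient (σ i) →ₗ[ℂ] (Y → Y → ℂ)
  coeff_ne_zero : ∀ i, coeff i ≠ 0
  coeff_equivariant : ∀ i g₁ g₂ v w y₁ y₂,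
    coeff i (σ i g₁ v) (contragredientRep (σ i) g₂ w) y₁ y₂ = coeff i v w (y₁ <• g₁) (y₂ <• g₂)
  form : ι → (Y → ℂ) → (Y → ℂ) → ℂ
  form_eq : ∀ i (K : Subgroup G), IsCompactOpen K → ∀ Φ₁ Φ₂ : Y → ℂ,
    IsTestFunction Φ₁ → IsTestFunction Φ₂ →
    (∀ k ∈ K, ∀ y : Y, Φ₁ (y <• k) = Φ₁ y) → (∀ k ∈ K, ∀ y : Y, Φ₂ (y <• k) = Φ₂ y) →
    ∀ b : DualBases (σ i) K, form i Φ₁ Φ₂ =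
      ∑ j, ∫ y₁, ∫ y₂, Φ₁ y₂ * star (Φ₂ y₁) * coeff i (b.basis j) (b.dualBasis j) y₁ y₂ ∂ν ∂ν
  form_nonneg : ∀ i Φ, IsTestFunction Φ → 0 ≤ (form i Φ Φ).re ∧ (form i Φ Φ).im = 0
  integrable : ∀ Φ₁ Φ₂, IsTestFunction Φ₁ → IsTestFunction Φ₂ →
    Integrable (fun i => form i Φ₁ Φ₂) μ
  plancherel : ∀ Φ₁ Φ₂, IsTestFunction Φ₁ → IsTestFunction Φ₂ →
    ∫ y, Φ₁ y * star (Φ₂ y) ∂ν = ∫ i, form i Φ₁ Φ₂ ∂μ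

namespace PlancherelDecomposition

attribute [instance] PlancherelDecomposition.measurableSpace PlancherelDecomposition.addCommGroup
  PlancherelDecomposition.module

variable {G : Type*} [Group G] [TopologicalSpace G] [ContinuousMul G]
  {Y : Type*} [TopologicalSpace Y] [MeasurableSpace Y] [MulAction Gᵐᵒᵖ Y] {ν : Measure Y}
  (P : PlancherelDecomposition.{w} G ν)
  {V W : Type*} [AddCommGroup V] [Module ℂ V] [AddCommGroup W] [Module ℂ W]

/-- `σ` appears in the Plancherel decomposition. -/
def Appears (σ : Representation ℂ G V) : Prop :=
  ∃ i, Nonempty (σ.Equiv (P.σ i))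

theorem contragredient_transport {σ : Representation ℂ G V} {τ : Representation ℂ G W}
    (e : σ.Equiv τ) (l : Module.Dual ℂ V) (hl : l ∈ contragredient σ) :
    e.toLinearEquiv.symm.toLinearMap.dualMap l ∈ contragredient τ := by
  obtain ⟨U, hU, hl⟩ := hl
  refine ⟨U, hU, fun k hk => ?_⟩
  ext w
  have h1 := LinearMap.congr_fun (hl k hk) (e.symm w)
  have h2 : e.symm (τ k⁻¹ w) = σ k⁻¹ (e.symm w) :=
    LinearMap.congr_fun (e.symm.isIntertwining' k⁻¹) w
  simp only [Representation.dual_apply, Module.Dual.transpose_apply, LinearMap.comp_apply] at h1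
  change l (e.symm (τ k⁻¹ w)) = l (e.symm w)
  rw [h2, h1]

/-- The isomorphism of contragredients induced by an isomorphism of representations. -/
def contragredientTransport {σ : Representation ℂ G V} {τ : Representation ℂ G W}
    (e : σ.Equiv τ) : contragredient σ →ₗ[ℂ] contragredient τ :=
  e.toLinearEquiv.symm.toLinearMap.dualMap.restrict (contragredient_transport e)

open Classical in
/-- The local period `Z_σ : σ × σ^∨ → ℂ` at the base point `y₀` of a representation `σ` that appears
in the Plancherel decomposition: evaluation of `σ ⊗ σ^∨ → C^∞(Y × Y)` at `(y₀, y₀)`. By Schur's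
lemma it does not depend on the isomorphism used to identify `σ` with its model. -/
def localPeriod (y₀ : Y) (σ : Representation ℂ G V) : V →ₗ[ℂ] contragredient σ →ₗ[ℂ] ℂ :=
  if h : P.Appears σ then
    let e := h.choose_spec.some
    ((P.coeff h.choose).compl₁₂ e.toLinearEquiv.toLinearMap (contragredientTransport e)).compr₂
      ((LinearMap.proj y₀ : (Y → ℂ) →ₗ[ℂ] ℂ).comp (LinearMap.proj y₀ : (Y → Y → ℂ) →ₗ[ℂ] (Y → ℂ)))
  else 0

open Classical in
/-- The local period on `σ × σ'` with respect to a pairing `B : σ × σ' → ℂ`, which identifies `σ'`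
with `σ^∨`. If `B` is invariant and `σ'` is smooth, then `B(·, w)` lies in `σ^∨` for all `w`. -/
def pairingPeriod (y₀ : Y) (σ : Representation ℂ G V) (B : V →ₗ[ℂ] W →ₗ[ℂ] ℂ) (v : V) (w : W) : ℂ :=
  if h : B.flip w ∈ contragredient σ then P.localPeriod y₀ σ v ⟨B.flip w, h⟩ else 0

end PlancherelDecomposition

/-! ## Base change and specialization -/

section BaseChange

variable {G : Type*} [Group G]

/-- Base change of a representation along an algebra `A → B`. -/
def repBaseChange {A : Type*} (B : Type*) [CommRing A] [CommRing B] [Algebra A B]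
    {V : Type*} [AddCommGroup V] [Module A V] (ρ : Representation A G V) :
    Representation B G (B ⊗[A] V) where
  toFun g := (ρ g).baseChange B
  map_one' := by simp [Module.End.one_eq_id]
  map_mul' g h := by simp [Module.End.mul_eq_comp, LinearMap.baseChange_comp]

/-- Base change of a bilinear pairing: `(b ⊗ v, b' ⊗ w) ↦ b b' ⟨v, w⟩`. -/
def pairingBaseChange {A : Type*} (B : Type*) [CommRing A] [CommRing B] [Algebra A B]
    {V W : Type*} [AddCommGroup V] [Module A V] [AddCommGroup W] [Module A W]
    (β : V →ₗ[A] W →ₗ[A] A) : (B ⊗[A] V) →ₗ[B] (B ⊗[A] W) →ₗ[B] B :=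
  LinearMap.liftBaseChange B
    { toFun := fun v => (TensorProduct.AlgebraTensorModule.rid A B B).toLinearMap ∘ₗ
        (β v).baseChange B
      map_add' := fun v v' => by rw [map_add, LinearMap.baseChange_add, LinearMap.comp_add]
      map_smul' := fun a v => by
        ext w
        change TensorProduct.AlgebraTensorModule.rid A B B ((1 : B) ⊗ₜ[A] (β (a • v) w)) =
          a • TensorProduct.AlgebraTensorModule.rid A B B ((1 : B) ⊗ₜ[A] (β v w))
        simp [mul_smul] }

theorem pairingBaseChange_tmul {A : Type*} (B : Type*) [CommRing A] [CommRing B] [Algebra A B]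
    {V W : Type*} [AddCommGroup V] [Module A V] [AddCommGroup W] [Module A W]
    (β : V →ₗ[A] W →ₗ[A] A) (b b' : B) (v : V) (w : W) :
    pairingBaseChange B β (b ⊗ₜ v) (b' ⊗ₜ w) = b * (b' * algebraMap A B (β v w)) := by
  simp [pairingBaseChange, Algebra.smul_def, mul_comm]

variable {k : Type*} [Field k] {V W : Type*} [AddCommGroup V] [Module k V]
  [AddCommGroup W] [Module k W]

/-- The complex vector space `V_τ = ℂ ⊗_{τ,k} V` for a field embedding `τ : k → ℂ`. -/
abbrev Twist (τ : k →+* ℂ) (V : Type*) [AddCommGroup V] [Module k V] : Type _ :=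
  @TensorProduct k _ ℂ V _ _ τ.toAlgebra.toModule _

/-- The natural map `V → V_τ`. -/
def Twist.of (τ : k →+* ℂ) (v : V) : Twist τ V :=
  @TensorProduct.tmul k _ ℂ V _ _ τ.toAlgebra.toModule _ 1 v

/-- The representation `ρ_τ` on `V_τ`. -/
def twistRep (τ : k →+* ℂ) (ρ : Representation k G V) : Representation ℂ G (Twist τ V) :=
  @repBaseChange G _ k ℂ _ _ τ.toAlgebra V _ _ ρ

/-- The linear extension of a pairing to `V_τ × W_τ`. -/
def twistPairing (τ : k →+* ℂ) (β : V →ₗ[k] W →ₗ[k] k) :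
    Twist τ V →ₗ[ℂ] Twist τ W →ₗ[ℂ] ℂ :=
  @pairingBaseChange k ℂ _ _ τ.toAlgebra V W _ _ _ _ β

end BaseChange

/-- The residue field `k(x)`. -/
abbrev resField {R : Type*} [CommRing R] (x : PrimeSpectrum R) : Type _ := x.asIdeal.ResidueField

/-- The specialization `V|_x = k(x) ⊗ V`. -/
abbrev Fiber {R : Type*} [CommRing R] (x : PrimeSpectrum R) (V : Type*) [AddCommGroup V]
    [Module R V] : Type _ := resField x ⊗[R] V

/-- The ring `Γ(U, 𝒪)` of regular functions on an open subset `U` of `Spec R`. -/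
abbrev regularFunctions (R : Type u) [CommRing R] (U : Opens (PrimeSpectrum R)) : Type u :=
  (AlgebraicGeometry.Spec.structureSheaf R).obj.obj (Opposite.op U)

instance (R : Type u) [CommRing R] (U : Opens (PrimeSpectrum R)) :
    Algebra R (regularFunctions R U) :=
  AlgebraicGeometry.StructureSheaf.openAlgebra R (Opposite.op U)

/-- The value in `k(x)` at `x ∈ U` of a regular function on `U`: the image of the germ under the
local homomorphism `𝒪_x = R_x → k(x)`. -/
def evalAt {R : Type u} [CommRing R] {U : Opens (PrimeSpectrum R)} (x : PrimeSpectrum R)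
    (hx : x ∈ U) (s : regularFunctions R U) : resField x :=
  IsLocalization.lift (M := x.asIdeal.primeCompl)
    (S := (AlgebraicGeometry.Spec.structureSheaf R).presheaf.stalk x)
    (g := algebraMap R (resField x))
    (fun y => IsUnit.mk0 _ fun h => y.2 (Ideal.algebraMap_residueField_eq_zero.1 h))
    (((AlgebraicGeometry.Spec.structureSheaf R).presheaf.germ U x hx).hom s)

/-- The meromorphic function `j ∈ Frac R` (total ring of fractions) is regular at `x` with value
`c ∈ k(x)`. -/
def HasValueAt {R : Type*} [CommRing R] (j : FractionRing R) (x : PrimeSpectrum R)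
    (c : resField x) : Prop :=
  ∃ r : R, ∃ s ∈ nonZeroDivisors R, s ∉ x.asIdeal ∧
    j * algebraMap R (FractionRing R) s = algebraMap R (FractionRing R) r ∧
    c * algebraMap R (resField x) s = algebraMap R (resField x) r

/-! ## Families of periods and of spherical characters -/

section Families

variable {G : Type*} [Group G] [TopologicalSpace G] [ContinuousMul G] [MeasurableSpace G]
  {Y : Type*} [TopologicalSpace Y] [MeasurableSpace Y] [MulAction Gᵐᵒᵖ Y] {ν : Measure Y}
  (P : PlancherelDecomposition.{w} G ν) (y₀ : Y)
  {R : Type u} [CommRing R] {V W : Type u} [AddCommGroup V] [Module R V]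
  [AddCommGroup W] [Module R W]

/-- The specialization `π|_x`. -/
def fiberRep (x : PrimeSpectrum R) (ρ : Representation R G V) :
    Representation (resField x) G (Fiber x V) :=
  repBaseChange (resField x) ρ

/-- The set `ℰ(π|_x)` of field embeddings `τ : k(x) → ℂ` such that `(π|_x)_τ` is irreducible and
appears in `L²(Y)`. -/
def goodEmbeddings (x : PrimeSpectrum R) (ρ : Representation R G V) : Set (resField x →+* ℂ) :=
  {τ | (twistRep τ (fiberRep x ρ)).IsIrreducible ∧ P.Appears (twistRep τ (fiberRep x ρ))}

/-- A family `π'` with an invariant pairing `B : π × π' → R` whose specializations at the points of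
`S` are non-degenerate. -/
structure IsDualFamily (S : Set (PrimeSpectrum R)) (ρ : Representation R G V)
    (ρ' : Representation R G W) (B : V →ₗ[R] W →ₗ[R] R) : Prop where
  isAdmissibleFamily : IsAdmissibleFamily ρ'
  invariant : IsInvariantPairing ρ ρ' B
  nondegenerate : ∀ x ∈ S, (pairingBaseChange (resField x) B).Nondegenerate

/-- `Zx` is the rational local period at `x`: it is bi-`H`-invariant, and for every `τ ∈ ℰ(π|_x)` it
is compatible with the local period of `(π|_x)_τ`, taken with respect to the linear extension of
the pairing. -/
def IsPeriodAt (H : Subgroup G) (ρ : Representation R G V) (ρ' : Representation R G W)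
    (B : V →ₗ[R] W →ₗ[R] R) (x : PrimeSpectrum R)
    (Zx : Fiber x V →ₗ[resField x] Fiber x W →ₗ[resField x] resField x) : Prop :=
  IsBiInvariantPairing H (fiberRep x ρ) (fiberRep x ρ') Zx ∧
  ∀ τ ∈ goodEmbeddings P x ρ, ∀ v w,
    τ (Zx v w) = P.pairingPeriod y₀ (twistRep τ (fiberRep x ρ))
      (twistPairing τ (pairingBaseChange (resField x) B)) (Twist.of τ v) (Twist.of τ w)

/-- Rationality of the local periods of `π`: for every dual family, and every `x ∈ S`, there is a
unique rational local period at `x`. -/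
def PeriodRationality (H : Subgroup G) (S : Set (PrimeSpectrum R)) (ρ : Representation R G V) :
    Prop :=
  ∀ (W : Type u) [AddCommGroup W] [Module R W] (ρ' : Representation R G W)
    (B : V →ₗ[R] W →ₗ[R] R), IsDualFamily S ρ ρ' B →
    ∀ x ∈ S, ∃! Zx : Fiber x V →ₗ[resField x] Fiber x W →ₗ[resField x] resField x,
      IsPeriodAt P y₀ H ρ ρ' B x Zx

/-- Meromorphy of the local periods of `π` with respect to a dual family `π'`: on an open subset `U`
containing `S` there is a bi-`H`-invariant pairing `π × π' → Γ(U, 𝒪)` that specializes to the rational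
local period at every point of `S`. -/
def PeriodMeromorphy (H : Subgroup G) (S : Set (PrimeSpectrum R)) (ρ : Representation R G V)
    (ρ' : Representation R G W) (B : V →ₗ[R] W →ₗ[R] R) : Prop :=
  ∃ (U : Opens (PrimeSpectrum R)) (hU : S ⊆ U) (Z : V →ₗ[R] W →ₗ[R] regularFunctions R U),
    IsBiInvariantPairing H ρ ρ' Z ∧
    ∀ (x : PrimeSpectrum R) (hx : x ∈ S),
      ∃ Zx : Fiber x V →ₗ[resField x] Fiber x W →ₗ[resField x] resField x,
        IsPeriodAt P y₀ H ρ ρ' B x Zx ∧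
        ∀ v w, evalAt x (hU hx) (Z v w) = Zx (1 ⊗ₜ v) (1 ⊗ₜ w)

/-- `J` is the rational spherical character at `x`: for every `τ ∈ ℰ(π|_x)` it is compatible with the
spherical character attached to the local period of `(π|_x)_τ`. -/
def IsCharacterAt (μ : Measure G) (ρ : Representation R G V) (x : PrimeSpectrum R)
    (J : heckeSpace G (resField x) →ₗ[resField x] resField x) : Prop :=
  ∀ τ ∈ goodEmbeddings P x ρ, ∀ f : heckeSpace G (resField x),
    τ (J f) = sphericalCharacter μ (twistRep τ (fiberRep x ρ))
      (P.localPeriod y₀ (twistRep τ (fiberRep x ρ))) (heckeSpace.map τ f)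

/-- Rationality of the spherical characters of `π`. -/
def CharacterRationality (μ : Measure G) (S : Set (PrimeSpectrum R)) (ρ : Representation R G V) :
    Prop :=
  ∀ x ∈ S, ∃! J : heckeSpace G (resField x) →ₗ[resField x] resField x, IsCharacterAt P y₀ μ ρ x J

/-- Meromorphy of the spherical characters of `π`: the rational spherical characters `J x`, `x ∈ S`,
exist, and for every `f ∈ S(G, E)` there is a unique meromorphic function that is regular at the
points `x ∈ S` with values `J x f`. -/
def CharacterMeromorphy (E : Type*) [CommRing E] [Algebra E R] (μ : Measure G)
    (S : Set (PrimeSpectrum R)) (ρ : Representation R G V) : Prop :=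
  ∃ J : ∀ x : PrimeSpectrum R, heckeSpace G (resField x) →ₗ[resField x] resField x,
    (∀ x ∈ S, IsCharacterAt P y₀ μ ρ x (J x)) ∧
    ∀ f : heckeSpace G E, ∃! j : FractionRing R, ∀ x ∈ S,
      HasValueAt j x
        (J x (heckeSpace.map ((algebraMap R (resField x)).comp (algebraMap E R)) f))

/-- The fibre ranks `x ↦ dim π^K|_x` are locally constant on `S` for all open compact `K`. -/
def HasLocallyConstantRanks (S : Set (PrimeSpectrum R)) (ρ : Representation R G V) : Prop :=
  ∀ K : Subgroup G, IsCompactOpen K →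
    IsLocallyConstant fun x : S => Module.finrank (resField x.1) (Fiber x.1 (fixedVectors ρ K))

end Families

/-! ## Linear algebraic groups and spherical varieties -/

section AlgebraicGroups

variable {F : Type*} [Field F] {n : ℕ}

/-- Subsets of `GL_n(L)` that are cut out by polynomials in the matrix entries over a subfield `k`. -/
def IsZariskiClosed (k : Type*) {L : Type*} [Field k] [Field L] [Algebra k L]
    (X : Set (GL (Fin n) L)) : Prop :=
  ∃ I : Set (MvPolynomial (Fin n × Fin n) k), ∀ g : GL (Fin n) L,
    g ∈ X ↔ ∀ p ∈ I, MvPolynomial.aeval (fun ij : Fin n × Fin n => g.1 ij.1 ij.2) p = 0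

variable {L : Type*} [Field L]

/-- A linear algebraic group over an algebraically closed field of characteristic zero is reductive
if it has no non-trivial closed normal unipotent subgroup (in characteristic zero, closed unipotent
subgroups are automatically connected). -/
def IsReductiveGroup (G : Subgroup (GL (Fin n) L)) : Prop :=
  ∀ N : Subgroup (GL (Fin n) L), N ≤ G → IsZariskiClosed L (N : Set (GL (Fin n) L)) →
    (N.subgroupOf G).Normal → (∀ g ∈ N, IsNilpotent (g.1 - 1)) → N = ⊥

/-- Closed connected subgroups: they have no proper closed subgroup of finite index. -/
def IsClosedConnected (B : Subgroup (GL (Fin n) L)) : Prop :=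
  IsZariskiClosed L (B : Set (GL (Fin n) L)) ∧
    ∀ C ≤ B, IsZariskiClosed L (C : Set (GL (Fin n) L)) → C.relIndex B ≠ 0 → C = B

/-- Borel subgroups: maximal closed connected solvable subgroups. -/
def IsBorelSubgroup (B G : Subgroup (GL (Fin n) L)) : Prop :=
  Maximal (fun C : Subgroup (GL (Fin n) L) => C ≤ G ∧ IsClosedConnected C ∧ Group.IsSolvable C) B

/-- `H \ G` is spherical: some Borel subgroup has an open orbit on it. -/
def IsSphericalSubgroup (H G : Subgroup (GL (Fin n) L)) : Prop :=
  ∃ B, IsBorelSubgroup B G ∧ ∃ g ∈ G,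
    IsZariskiClosed L {x : GL (Fin n) L | x ∈ G ∧ ¬ ∃ h ∈ H, ∃ b ∈ B, x = h * g * b}

variable (F) in
/-- A pair `H ⊆ G` of reductive groups over `F` such that `H \ G` is spherical. The groups are given
as subgroups of `GL_n` over an algebraic closure that are defined over `F`. -/
structure SphericalPair where
  n : ℕ
  G : Subgroup (GL (Fin n) (AlgebraicClosure F))
  H : Subgroup (GL (Fin n) (AlgebraicClosure F))
  le : H ≤ G
  closed_G : IsZariskiClosed F (G : Set (GL (Fin n) (AlgebraicClosure F)))
  closed_H : IsZariskiClosed F (H : Set (GL (Fin n) (AlgebraicClosure F)))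
  reductive_G : IsReductiveGroup G
  reductive_H : IsReductiveGroup H
  spherical : IsSphericalSubgroup H G

namespace SphericalPair

variable (X : SphericalPair F)

/-- The inclusion `GL_n(F) → GL_n(F̄)`. -/
def incl : GL (Fin X.n) F →* GL (Fin X.n) (AlgebraicClosure F) :=
  Matrix.GeneralLinearGroup.map (algebraMap F (AlgebraicClosure F))

/-- The action of the Galois group on `GL_n(F̄)`. -/
def galois (s : AlgebraicClosure F ≃ₐ[F] AlgebraicClosure F) :
    GL (Fin X.n) (AlgebraicClosure F) →* GL (Fin X.n) (AlgebraicClosure F) :=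
  Matrix.GeneralLinearGroup.map (s : AlgebraicClosure F →+* AlgebraicClosure F)

theorem galois_incl (s : AlgebraicClosure F ≃ₐ[F] AlgebraicClosure F) (g : GL (Fin X.n) F) :
    X.galois s (X.incl g) = X.incl g := by
  ext i j
  simp [galois, incl]

/-- The group `G(F)`. -/
def GF : Subgroup (GL (Fin X.n) F) := X.G.comap X.incl

/-- The subgroup `H(F)` of `G(F)`. -/
def HF : Subgroup X.GF := (X.H.comap X.incl).subgroupOf X.GF

/-- The elements `g ∈ G(F̄)` whose coset `H(F̄) g` is stable under the Galois group. -/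
def RationalCosetRep : Type _ :=
  {g : GL (Fin X.n) (AlgebraicClosure F) // g ∈ X.G ∧ ∀ s, X.galois s g * g⁻¹ ∈ X.H}

/-- Equality of the cosets `H(F̄) g` and `H(F̄) g'`. -/
def cosetSetoid : Setoid X.RationalCosetRep where
  r g g' := g'.1 * g.1⁻¹ ∈ X.H
  iseqv :=
    { refl := fun g => by simp [X.H.one_mem]
      symm := fun {g g'} h => by simpa using X.H.inv_mem h
      trans := fun {g g' g''} h h' => by simpa [mul_assoc] using X.H.mul_mem h' h }

/-- The set `Y(F)` of `F`-rational points of `Y = H \ G`, i.e. of Galois-stable cosets `H(F̄) g`. -/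
def YF : Type _ := Quotient X.cosetSetoid

/-- Right translation by `G(F)` on coset representatives. -/
def translate (g : X.GF) (y : X.RationalCosetRep) : X.RationalCosetRep :=
  ⟨y.1 * X.incl g.1, X.G.mul_mem y.2.1 g.2, fun s => by
    have h : X.galois s (y.1 * X.incl g.1) * (y.1 * X.incl g.1)⁻¹ = X.galois s y.1 * y.1⁻¹ := by
      rw [map_mul, galois_incl]
      group
    rw [h]
    exact y.2.2 s⟩

/-- The right action of `G(F)` on `Y(F)`. -/
instance : MulAction X.GFᵐᵒᵖ X.YF where
  smul g := Quotient.map (X.translate g.unop) fun y y' (h : y'.1 * y.1⁻¹ ∈ X.H) => by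
    change (y'.1 * X.incl g.unop.1) * (y.1 * X.incl g.unop.1)⁻¹ ∈ X.H
    have e : (y'.1 * X.incl g.unop.1) * (y.1 * X.incl g.unop.1)⁻¹ = y'.1 * y.1⁻¹ := by group
    rw [e]
    exact h
  one_smul y := by
    induction y using Quotient.inductionOn with
    | h y =>
      refine congrArg (Quotient.mk _) (Subtype.ext ?_)
      simp [translate]
  mul_smul g g' y := by
    induction y using Quotient.inductionOn with
    | h y =>
      refine congrArg (Quotient.mk _) (Subtype.ext ?_)
      simp [translate, mul_assoc]

/-- The base point `H · 1` of `Y(F)`. -/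
def basePoint : X.YF := Quotient.mk X.cosetSetoid ⟨1, X.G.one_mem, fun s => by simp [X.H.one_mem]⟩

variable [TopologicalSpace F]

/-- The `p`-adic topology on `Y(F)`: the finest one for which all orbit maps `G(F) → Y(F)` are
continuous (the orbits of `G(F)` on `Y(F)` are open). -/
instance : TopologicalSpace X.YF :=
  ⨆ y : X.YF, TopologicalSpace.coinduced (fun g : X.GF => y <• g) inferInstance

instance : MeasurableSpace X.YF := borel _

instance : BorelSpace X.YF := ⟨rfl⟩

instance : MeasurableSpace X.GF := borel _

instance : BorelSpace X.GF := ⟨rfl⟩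

end SphericalPair

end AlgebraicGroups

end

/-! The point is a basis-free description of the spherical character that makes sense over any field
of characteristic zero. For a smooth admissible `π` and a Hecke function `f` the operator `π(f)` has
finite rank. A pairing `β : V × W → k` without right kernel embeds `V ⊗ W` into `End V` by `v ⊗ w ↦
β(·, w) v` (`rankOp_injective`). If `t` is the tensor that represents `π(f)`, the character is
`Z(t)`. Over `ℂ` dual bases give `t = ∑ σ(f) φᵢ ⊗ φⁱ`, so this recovers the definition for every
choice of level and bases (`sphericalCharacter_eq`). Since the formation of `t` commutes with field
embeddings, a period over `k(x)` gives a character over `k(x)` (`sphericalCharacter_twist`,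
`exists_isCharacterAt`). Rational Haar volumes are what define `π(f)` over `k(x)`.

Existence of `t` uses Gram matrices: if the vectors `mᵢ` span `V^K` and the `K`-fixed `nⱼ` make `M =
(β(mᵢ, nⱼ))` invertible, then `t = ∑ (M⁻¹)ⱼᵢ π(f) mᵢ ⊗ nⱼ` (`rankOp_eq_heckeOp`). Non-degeneracy of
the fibre pairing provides such vectors, and they can be chosen in the family itself
(`exists_gram`).

For (1) one dual family is needed in order to invoke (P-rat), and the contragredient serves. It is
finitely generated because irreducibility after one embedding in `ℂ` forces every non-zero smooth
form to generate it (`contragredient_finite`, `separating_of_isIrreducible_twist`).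

For (2) the Gram data at `x` remain good near `x`: spanning persists by Nakayama
(`exists_span_nearby`), and `det M` stays invertible. Near `x` the character is therefore `det(M)⁻¹
∑ adj(M)ⱼᵢ Z(π(f) mᵢ, nⱼ)`, a fraction of elements of `R` (`exists_local_character`). On a reduced
Noetherian ring such local fractions on a dense set come from one element of `Frac R`, by prime
avoidance in the ideal of denominators (`existsUnique_meromorphic`). -/

noncomputable section

/-! ### Regular and meromorphic functions on `Spec R`, and Nakayama's lemma at a point. -/

section RegularFunctions

variable {R : Type u} [CommRing R]

/-- The evaluation homomorphism at a point of `U`. -/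
def evalHom {U : Opens (PrimeSpectrum R)} (x : PrimeSpectrum R) (hx : x ∈ U) :
    regularFunctions R U →+* resField x :=
  (IsLocalization.lift (M := x.asIdeal.primeCompl)
    (S := (AlgebraicGeometry.Spec.structureSheaf R).presheaf.stalk x)
    (g := algebraMap R (resField x))
    (fun y => IsUnit.mk0 _ fun h => y.2 (Ideal.algebraMap_residueField_eq_zero.1 h))).comp
    ((AlgebraicGeometry.Spec.structureSheaf R).presheaf.germ U x hx).hom

theorem evalHom_apply {U : Opens (PrimeSpectrum R)} (x : PrimeSpectrum R) (hx : x ∈ U)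
    (s : regularFunctions R U) : evalHom x hx s = evalAt x hx s := rfl

theorem germ_algebraMap (U : Opens (PrimeSpectrum R)) (x : PrimeSpectrum R) (hx : x ∈ U) (r : R) :
    ((AlgebraicGeometry.Spec.structureSheaf R).presheaf.germ U x hx).hom
      (algebraMap R (regularFunctions R U) r) =
    algebraMap R ((AlgebraicGeometry.Spec.structureSheaf R).presheaf.stalk x) r :=
  AlgebraicGeometry.StructureSheaf.algebraMap_germ_apply U x hx r

theorem evalHom_algebraMap {U : Opens (PrimeSpectrum R)} (x : PrimeSpectrum R) (hx : x ∈ U)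
    (r : R) : evalHom x hx (algebraMap R (regularFunctions R U) r) = algebraMap R (resField x) r := by
  simp only [evalHom, RingHom.comp_apply]
  erw [germ_algebraMap]
  exact IsLocalization.lift_eq _ _

/-- A regular function is a fraction in a neighbourhood of every point. -/
theorem exists_local_fraction {U : Opens (PrimeSpectrum R)} (s : regularFunctions R U)
    (x : PrimeSpectrum R) (hx : x ∈ U) :
    ∃ a h : R, h ∉ x.asIdeal ∧ ∀ (y : PrimeSpectrum R) (hy : y ∈ U), h ∉ y.asIdeal →
      algebraMap R (resField y) h * evalHom y hy s = algebraMap R (resField y) a := by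
  set g := ((AlgebraicGeometry.Spec.structureSheaf R).presheaf.germ U x hx).hom with hg
  obtain ⟨⟨a, h⟩, hah⟩ := IsLocalization.surj (M := x.asIdeal.primeCompl) (g s)
  have hgr : ∀ r : R, g (algebraMap R (regularFunctions R U) r) =
      algebraMap R ((AlgebraicGeometry.Spec.structureSheaf R).presheaf.stalk x) r := germ_algebraMap U x hx
  have e : g (s * algebraMap R (regularFunctions R U) h) =
      g (algebraMap R (regularFunctions R U) a) := by
    rw [map_mul, hgr, hgr, hah]
  obtain ⟨W, hxW, iU, iV, hW⟩ := TopCat.Presheaf.germ_eq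
    (AlgebraicGeometry.Spec.structureSheaf R).presheaf x hx hx _ _ e
  obtain ⟨_, ⟨t, rfl⟩, hxt, htW⟩ := PrimeSpectrum.isTopologicalBasis_basic_opens.exists_subset_of_mem_open
    hxW W.isOpen
  -- The identity `s h = a` of germs at `x` holds on `W`. The factor `t`, with `x ∈ D(t) ⊆ W`,
  -- forces every `y` outside the zero locus of `t h` into `W`.
  refine ⟨t * a, t * h, fun hmem => ?_, fun y hy hty => ?_⟩
  · rcases x.isPrime.mem_or_mem hmem with h1 | h1
    exacts [hxt h1, h.2 h1]
  · have hyW : y ∈ W := htW fun hm => hty (Ideal.mul_mem_right _ _ hm)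
    have e2 : ((AlgebraicGeometry.Spec.structureSheaf R).presheaf.germ U y hy).hom
          (s * algebraMap R (regularFunctions R U) h) =
        ((AlgebraicGeometry.Spec.structureSheaf R).presheaf.germ U y hy).hom
          (algebraMap R (regularFunctions R U) a) := by
      have := congrArg ((AlgebraicGeometry.Spec.structureSheaf R).presheaf.germ W y hyW) hW
      erw [TopCat.Presheaf.germ_res_apply, TopCat.Presheaf.germ_res_apply] at this
      exact this
    have e3 : evalHom y hy (s * algebraMap R (regularFunctions R U) h) =
        evalHom y hy (algebraMap R (regularFunctions R U) a) := by
      simp only [evalHom, RingHom.comp_apply]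
      erw [e2]
    rw [map_mul, evalHom_algebraMap, evalHom_algebraMap] at e3
    rw [map_mul, map_mul, ← e3]
    ring

/-- The zero locus of `a` is closed, so it contains the closure of `S`; hence `a` lies in every
prime and is nilpotent. -/
theorem eq_zero_of_dense [IsReduced R] {S : Set (PrimeSpectrum R)} (hS : Dense S) {a : R}
    (ha : ∀ x ∈ S, a ∈ x.asIdeal) : a = 0 := by
  have h1 : closure S ⊆ PrimeSpectrum.zeroLocus {a} :=
    closure_minimal (fun x hx => by simpa using ha x hx) (PrimeSpectrum.isClosed_zeroLocus _)
  rw [hS.closure_eq] at h1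
  have h2 : a ∈ nilradical R := by
    rw [nilradical_eq_sInf, Submodule.mem_sInf]
    intro p hp
    simpa using h1 (Set.mem_univ (⟨p, hp⟩ : PrimeSpectrum R))
  exact (mem_nilradical.1 h2).eq_zero

/-- In a reduced ring the zero divisors are covered by the minimal primes. This turns regularity of
a denominator into a condition suited to prime avoidance. -/
theorem mem_nonZeroDivisors_of_forall_notMem_minimalPrimes [IsReduced R] {s : R}
    (hs : ∀ p ∈ minimalPrimes R, s ∉ p) : s ∈ nonZeroDivisors R := by
  rw [mem_nonZeroDivisors_iff_right]
  intro y hy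
  by_contra hne
  have h : s ∈ ⋃ p ∈ (⊥ : Ideal R).minimalPrimes, (p : Set R) := by
    rw [Ideal.iUnion_minimalPrimes]
    have hr : (⊥ : Ideal R).radical = ⊥ := nilradical_eq_zero R
    refine ⟨y, ?_, ?_⟩
    · rwa [hr, Ideal.mem_bot]
    · rw [hr, Ideal.mem_bot, mul_comm, hy]
  simp only [Set.mem_iUnion] at h
  obtain ⟨p, hp, hsp⟩ := h
  exact hs p hp hsp

/-- An ideal that is not contained in any point of a dense set is not contained in any minimal
prime. -/
theorem not_le_minimalPrimes_of_dense [IsNoetherianRing R] {S : Set (PrimeSpectrum R)}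
    (hS : Dense S) {I : Ideal R} (hI : ∀ x ∈ S, ¬ I ≤ x.asIdeal) {p : Ideal R}
    (hp : p ∈ minimalPrimes R) : ¬ I ≤ p := by
  intro hIp
  have hpp : p.IsPrime := hp.1.1
  -- An element `t` of all the other minimal primes but not of `p` defines an open set around `p`
  -- whose points lie over no minimal prime except `p`. A point of `S` in this set then contains
  -- `p`, hence `I`.
  let T := ((minimalPrimes.finite_of_isNoetherianRing R).toFinset).erase p
  have hT : ¬ T.inf id ≤ p := by
    rw [hpp.inf_le']
    rintro ⟨q, hq, hqp⟩
    have hq' : q ≠ p ∧ q ∈ minimalPrimes R := by simpa [T] using hq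
    exact hq'.1 (le_antisymm hqp (hp.2 hq'.2.1 hqp))
  obtain ⟨t, ht, htp⟩ := SetLike.not_le_iff_exists.1 hT
  obtain ⟨x, hxt, hxS⟩ := hS.inter_open_nonempty _ (PrimeSpectrum.basicOpen t).isOpen
    ⟨⟨p, hpp⟩, htp⟩
  obtain ⟨q, hq, hqx⟩ := Ideal.exists_minimalPrimes_le (I := ⊥) (J := x.asIdeal) bot_le
  by_cases hqp : q = p
  · exact hI x hxS (hIp.trans (hqp ▸ hqx))
  · have h1 : t ∈ q := by
      have : T.inf id ≤ q := Finset.inf_le (f := id) (by simpa [T] using ⟨hqp, hq⟩)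
      exact this ht
    exact hxt (hqx h1)

/-- A function on a dense set of points of a reduced Noetherian scheme that is locally given by
fractions extends uniquely to a meromorphic function that is regular at these points. -/
theorem existsUnique_meromorphic [IsNoetherianRing R] [IsReduced R] {S : Set (PrimeSpectrum R)}
    (hS : Dense S) (c : ∀ x : PrimeSpectrum R, resField x)
    (hc : ∀ x ∈ S, ∃ s r : R, s ∉ x.asIdeal ∧ ∀ y ∈ S, s ∉ y.asIdeal →
      c y * algebraMap R (resField y) s = algebraMap R (resField y) r) :
    ∃! j : FractionRing R, ∀ x ∈ S, HasValueAt j x (c x) := by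
  -- The ideal of denominators: those `a` for which `a c` is given on all of `S` by a single element
  -- of `R`.
  let I : Ideal R :=
    { carrier := {a | ∃ r, ∀ y ∈ S, c y * algebraMap R (resField y) a =
        algebraMap R (resField y) r}
      zero_mem' := ⟨0, fun y _ => by simp⟩
      add_mem' := by
        rintro a b ⟨r, hr⟩ ⟨r', hr'⟩
        exact ⟨r + r', fun y hy => by rw [map_add, mul_add, hr y hy, hr' y hy, map_add]⟩
      smul_mem' := by
        rintro d a ⟨r, hr⟩
        exact ⟨d * r, fun y hy => by
          rw [smul_eq_mul, map_mul, mul_left_comm, hr y hy, map_mul]⟩ }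
  have hI : ∀ x ∈ S, ¬ I ≤ x.asIdeal := by
    intro x hx hle
    obtain ⟨s, r, hsx, h⟩ := hc x hx
    -- The square turns a local denominator into a global one: `c s² = r s` also holds where `s`
    -- vanishes, because both sides are zero there.
    have hs : s * s ∈ I := by
      refine ⟨r * s, fun y hy => ?_⟩
      by_cases hsy : s ∈ y.asIdeal
      · simp [Ideal.algebraMap_residueField_eq_zero.2 hsy]
      · rw [map_mul, ← mul_assoc, h y hy hsy, map_mul]
    exact (x.isPrime.mem_or_mem (hle hs)).elim hsx hsx
  have hreg : ∀ x ∈ S, ∃ s ∈ I, s ∈ nonZeroDivisors R ∧ s ∉ x.asIdeal := by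
    intro x hx
    let T := (minimalPrimes.finite_of_isNoetherianRing R).toFinset
    have hmin : ∀ p ∈ insert x.asIdeal T, p.IsPrime ∧ ¬ I ≤ p := by
      intro p hp
      rcases Finset.mem_insert.1 hp with rfl | hp
      · exact ⟨x.isPrime, hI x hx⟩
      · have hp' : p ∈ minimalPrimes R := by simpa [T] using hp
        exact ⟨hp'.1.1, not_le_minimalPrimes_of_dense hS hI hp'⟩
    -- Prime avoidance for the minimal primes together with `x` yields a denominator that is regular
    -- and does not vanish at `x`.
    have hav : ¬ ((I : Set R) ⊆ ⋃ p ∈ (↑(insert x.asIdeal T) : Set (Ideal R)), (id p : Ideal R)) := by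
      rw [Ideal.subset_union_prime (f := id) ⊥ ⊥ fun p hp _ _ => (hmin p hp).1]
      rintro ⟨p, hp, hle⟩
      exact (hmin p hp).2 hle
    obtain ⟨s, hsI, hs⟩ := Set.not_subset.1 hav
    simp only [Set.mem_iUnion, not_exists] at hs
    refine ⟨s, hsI, mem_nonZeroDivisors_of_forall_notMem_minimalPrimes fun p hp => ?_, ?_⟩
    · exact hs p (by simp [T, hp])
    · exact hs x.asIdeal (by simp)
  have hvan : ∀ a : R, (∀ y ∈ S, algebraMap R (resField y) a = 0) → a = 0 := fun a ha =>
    eq_zero_of_dense hS fun y hy => Ideal.algebraMap_residueField_eq_zero.1 (ha y hy)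
  refine existsUnique_of_exists_of_unique ?_ ?_
  · rcases S.eq_empty_or_nonempty with rfl | ⟨x₀, hx₀⟩
    · exact ⟨0, by simp⟩
    obtain ⟨s₀, ⟨r₀, hr₀⟩, hs₀, -⟩ := hreg x₀ hx₀
    -- One global denominator suffices: for any other `s` in `I` with numerator `r`, the element `r
    -- s₀ - r₀ s` vanishes on `S`, so it is zero and the two fractions coincide.
    refine ⟨IsLocalization.mk' _ r₀ ⟨s₀, hs₀⟩, fun x hx => ?_⟩
    obtain ⟨s, ⟨r, hr⟩, hs, hsx⟩ := hreg x hx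
    refine ⟨r, s, hs, hsx, ?_, hr x hx⟩
    rw [mul_comm, IsLocalization.mul_mk'_eq_mk'_of_mul, IsLocalization.mk'_eq_iff_eq_mul, ← map_mul]
    congr 1
    refine sub_eq_zero.1 (hvan _ fun y hy => ?_)
    rw [map_sub, map_mul, map_mul, ← hr y hy, ← hr₀ y hy]
    ring
  · intro j j' hj hj'
    obtain ⟨⟨a, b⟩, hab⟩ := IsLocalization.surj (M := nonZeroDivisors R) (j - j')
    have ha : a = 0 := by
      refine hvan a fun x hx => ?_
      obtain ⟨r, s, hs, hsx, h1, h2⟩ := hj x hx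
      obtain ⟨r', s', hs', hsx', h1', h2'⟩ := hj' x hx
      -- Here `j - j' = a / b`. At `x` the right side becomes `b (c s s' - c s' s) = 0`, while `s`
      -- and `s'` are non-zero there, so `a` vanishes at `x`.
      have e : a * (s * s') = b * (r * s' - r' * s) := by
        apply IsFractionRing.injective R (FractionRing R)
        simp only [map_mul, map_sub]
        rw [← hab, ← h1, ← h1']
        ring
      have e' := congrArg (algebraMap R (resField x)) e
      simp only [map_mul, map_sub] at e'
      rw [← h2, ← h2'] at e'
      have hne : algebraMap R (resField x) s * algebraMap R (resField x) s' ≠ 0 :=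
        mul_ne_zero (fun h => hsx (Ideal.algebraMap_residueField_eq_zero.1 h))
          (fun h => hsx' (Ideal.algebraMap_residueField_eq_zero.1 h))
      refine (mul_eq_zero.1 (e'.trans ?_)).resolve_right hne
      ring
    rw [ha, map_zero] at hab
    exact sub_eq_zero.1 (((IsLocalization.map_units (FractionRing R) b).mul_left_eq_zero).1 hab)

/-- Elements of a finite module that span a fibre span the module in a neighbourhood. -/
theorem exists_smul_mem_span {M : Type*} [AddCommGroup M] [Module R M] [Module.Finite R M]
    (x : PrimeSpectrum R) {ι : Type*} (m : ι → M)
    (hm : Submodule.span (resField x) (Set.range fun i => (1 : resField x) ⊗ₜ[R] m i) = ⊤) :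
    ∃ g : R, g ∉ x.asIdeal ∧ ∀ v : M, g • v ∈ Submodule.span R (Set.range m) := by
  set N := Submodule.span R (Set.range m) with hN
  -- This says that the fibre of `M → M ⧸ N` is the zero map. As it is also surjective, the fibre of
  -- `M ⧸ N` vanishes and `x` is outside its support.
  have hmap : (resField x ∙ (0 : resField x ⊗[R] (M ⧸ N))) =
      Submodule.map (N.mkQ.baseChange (resField x)) ⊤ := by
    rw [← hm, Submodule.map_span, ← Set.range_comp, Submodule.span_zero_singleton]
    symm
    rw [Submodule.span_eq_bot]
    rintro _ ⟨i, rfl⟩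
    have : N.mkQ (m i) = 0 := by
      rw [Submodule.mkQ_apply, Submodule.Quotient.mk_eq_zero]
      exact Submodule.subset_span ⟨i, rfl⟩
    simp [this]
  have hsub : Subsingleton (resField x ⊗[R] (M ⧸ N)) := by
    refine subsingleton_of_forall_eq 0 fun t => ?_
    obtain ⟨u, rfl⟩ : ∃ u, N.mkQ.baseChange (resField x) u = t :=
      LinearMap.lTensor_surjective (resField x) N.mkQ_surjective t
    have : N.mkQ.baseChange (resField x) u ∈ (resField x ∙ (0 : resField x ⊗[R] (M ⧸ N))) :=
      hmap ▸ Submodule.mem_map_of_mem trivial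
    simpa using this
  have hx : x ∉ Module.support R (M ⧸ N) := by
    rw [Module.mem_support_iff_nontrivial_residueField_tensorProduct]
    exact not_nontrivial_iff_subsingleton.2 hsub
  rw [Module.mem_support_iff_of_finite] at hx
  obtain ⟨g, hg, hgx⟩ := SetLike.not_le_iff_exists.1 hx
  refine ⟨g, hgx, fun v => ?_⟩
  have := Module.mem_annihilator.1 hg (N.mkQ v)
  rwa [← map_smul, Submodule.mkQ_apply, Submodule.Quotient.mk_eq_zero] at this

end RegularFunctions

/-! ### Fixed vectors and base change. -/

section FixedVectors

variable {G : Type*} [Group G] {A : Type*} [CommRing A] {V : Type*} [AddCommGroup V] [Module A V]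

theorem fixedVectors_anti (ρ : Representation A G V) {K L : Subgroup G} (h : L ≤ K) :
    fixedVectors ρ K ≤ fixedVectors ρ L := fun _ hv k hk => hv k (h hk)

variable (B : Type*) [CommRing B] [Algebra A B]

theorem repBaseChange_tmul (ρ : Representation A G V) (g : G) (b : B) (v : V) :
    repBaseChange B ρ g (b ⊗ₜ v) = b ⊗ₜ ρ g v := by
  simp [repBaseChange]

theorem tmul_mem_fixedVectors (ρ : Representation A G V) {K : Subgroup G} {v : V}
    (hv : v ∈ fixedVectors ρ K) (b : B) : b ⊗ₜ v ∈ fixedVectors (repBaseChange B ρ) K :=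
  fun k hk => by rw [repBaseChange_tmul, hv k hk]

end FixedVectors

/-! ### Averaging over compact open subgroups. -/

section Averaging

variable {G : Type*} [Group G] [TopologicalSpace G] [ContinuousMul G]

theorem IsCompactOpen.inf {K U : Subgroup G} (hK : IsCompactOpen K) (hU : IsOpen (U : Set G)) :
    IsCompactOpen (K ⊓ U) :=
  ⟨hK.1.inter hU, hK.2.inter_right (Subgroup.isClosed_of_isOpen U hU)⟩

theorem IsCompactOpen.finite_quotient {K U : Subgroup G} (hK : IsCompactOpen K)
    (hU : IsOpen (U : Set G)) : Finite (K ⧸ U.subgroupOf K) := by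
  have : CompactSpace K := isCompact_iff_compactSpace.1 hK.2
  have : ContinuousMul K := K.toSubmonoid.continuousMul
  exact Subgroup.quotient_finite_of_isOpen _ (Subgroup.subgroupOf_isOpen K U hU)

theorem IsCompactOpen.relIndex_ne_zero {K U : Subgroup G} (hK : IsCompactOpen K)
    (hU : IsOpen (U : Set G)) : U.relIndex K ≠ 0 := by
  have := hK.finite_quotient hU
  exact Subgroup.index_ne_zero_of_finite

variable {A : Type*} [CommRing A] {V : Type*} [AddCommGroup V] [Module A V]

/-- The average over `K` of vectors fixed by an open subgroup `U`. -/
def repAverage (ρ : Representation A G V) (K U : Subgroup G) : V →ₗ[A] V :=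
  Ring.inverse ((U.relIndex K : ℕ) : A) • ∑ᶠ q : K ⧸ U.subgroupOf K, ρ (q.out : G)

theorem repAverage_apply (ρ : Representation A G V) {K U : Subgroup G} (hK : IsCompactOpen K)
    (hU : IsOpen (U : Set G)) (v : V) : repAverage ρ K U v =
      Ring.inverse ((U.relIndex K : ℕ) : A) • ∑ᶠ q : K ⧸ U.subgroupOf K, ρ (q.out : G) v := by
  have := hK.finite_quotient hU
  have := Fintype.ofFinite (K ⧸ U.subgroupOf K)
  simp [repAverage, finsum_eq_sum_of_fintype]

theorem repAverage_mem (ρ : Representation A G V) {K U : Subgroup G} (hK : IsCompactOpen K)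
    (hU : IsOpen (U : Set G)) {v : V} (hv : v ∈ fixedVectors ρ U) :
    repAverage ρ K U v ∈ fixedVectors ρ K := by
  rw [repAverage_apply ρ hK hU]
  refine Submodule.smul_mem _ _ fun k hk => ?_
  have := hK.finite_quotient hU
  have := Fintype.ofFinite (K ⧸ U.subgroupOf K)
  rw [finsum_eq_sum_of_fintype, map_sum]
  -- On a `U`-fixed vector the summands do not depend on the representatives, so translation by `k`
  -- merely permutes them.
  have hout : ∀ a b : K, (QuotientGroup.mk a : K ⧸ U.subgroupOf K) = QuotientGroup.mk b →
      ρ (a : G) v = ρ (b : G) v := by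
    intro a b hab
    have h := hv _ (Subgroup.mem_subgroupOf.1 (QuotientGroup.eq.1 hab))
    calc ρ (a : G) v = ρ (a : G) (ρ ((a⁻¹ * b : K) : G) v) := by rw [h]
      _ = ρ (b : G) v := by
        rw [← Module.End.mul_apply, ← map_mul]
        simp
  rw [← Equiv.sum_comp (MulAction.toPerm (⟨k, hk⟩ : K)) fun q : K ⧸ U.subgroupOf K =>
    ρ (q.out : G) v]
  refine Finset.sum_congr rfl fun q _ => ?_
  rw [← Module.End.mul_apply, ← map_mul]
  refine hout (⟨k, hk⟩ * q.out) _ ?_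
  rw [QuotientGroup.out_eq', MulAction.toPerm_apply, ← smul_eq_mul, ← MulAction.Quotient.smul_mk,
    QuotientGroup.out_eq']

/-- Each of the `[K : K ∩ U]` summands has the same image under `φ`. This is the device by which
statements about `V` are reduced to `V^K`. -/
theorem apply_repAverage (hA : ∀ n : ℕ, n ≠ 0 → IsUnit (n : A)) (ρ : Representation A G V)
    {K U : Subgroup G} (hK : IsCompactOpen K) (hU : IsOpen (U : Set G)) {P : Type*}
    [AddCommGroup P] [Module A P] (φ : V →ₗ[A] P) (v : V) (hφ : ∀ k ∈ K, φ (ρ k v) = φ v) :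
    φ (repAverage ρ K U v) = φ v := by
  have := hK.finite_quotient hU
  have := Fintype.ofFinite (K ⧸ U.subgroupOf K)
  rw [repAverage_apply ρ hK hU, finsum_eq_sum_of_fintype, map_smul, map_sum,
    Finset.sum_congr rfl fun (q : K ⧸ U.subgroupOf K) _ => hφ q.out q.out.2, Finset.sum_const,
    Finset.card_univ, ← Nat.card_eq_fintype_card, ← Nat.cast_smul_eq_nsmul A, smul_smul]
  change (Ring.inverse ((U.relIndex K : ℕ) : A) * (U.relIndex K : A)) • φ v = φ v
  rw [Ring.inverse_mul_cancel _ (hA _ (hK.relIndex_ne_zero hU)), one_smul]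

theorem repAverage_eq_self (hA : ∀ n : ℕ, n ≠ 0 → IsUnit (n : A)) (ρ : Representation A G V)
    {K U : Subgroup G} (hK : IsCompactOpen K) (hU : IsOpen (U : Set G)) {v : V}
    (hv : v ∈ fixedVectors ρ K) : repAverage ρ K U v = v :=
  apply_repAverage hA ρ hK hU LinearMap.id v hv

theorem IsSmoothRep.exists_common {ρ : Representation A G V} (hρ : IsSmoothRep ρ)
    (s : Finset V) : ∃ K : Subgroup G, IsCompactOpen K ∧ ∀ v ∈ s, v ∈ fixedVectors ρ K := by
  classical
  induction s using Finset.induction_on with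
  | empty =>
    obtain ⟨K, hK, -⟩ := hρ 0
    exact ⟨K, hK, by simp⟩
  | insert a s _ ih =>
    obtain ⟨K, hK, h⟩ := ih
    obtain ⟨L, hL, ha⟩ := hρ a
    refine ⟨K ⊓ L, hK.inf hL.1, fun v hv => ?_⟩
    rcases Finset.mem_insert.1 hv with rfl | hv
    · exact fixedVectors_anti ρ inf_le_right ha
    · exact fixedVectors_anti ρ inf_le_left (h v hv)

variable (B : Type*) [CommRing B] [Algebra A B]

theorem IsSmoothRep.baseChange {ρ : Representation A G V} (hρ : IsSmoothRep ρ) :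
    IsSmoothRep (repBaseChange B ρ) := by
  intro t
  induction t with
  | zero =>
    obtain ⟨K, hK, -⟩ := hρ 0
    exact ⟨K, hK, Submodule.zero_mem _⟩
  | tmul b v =>
    obtain ⟨K, hK, hv⟩ := hρ v
    exact ⟨K, hK, tmul_mem_fixedVectors B ρ hv b⟩
  | add s t hs ht =>
    obtain ⟨K, hK, hs⟩ := hs
    obtain ⟨L, hL, ht⟩ := ht
    exact ⟨K ⊓ L, hK.inf hL.1, Submodule.add_mem _ (fixedVectors_anti _ inf_le_left hs)
      (fixedVectors_anti _ inf_le_right ht)⟩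

/-- The index is a unit already in `A`, so its inverse is compatible with `A → B`. -/
theorem repAverage_tmul (hA : ∀ n : ℕ, n ≠ 0 → IsUnit (n : A)) (ρ : Representation A G V)
    {K U : Subgroup G} (hK : IsCompactOpen K) (hU : IsOpen (U : Set G)) (b : B) (v : V) :
    repAverage (repBaseChange B ρ) K U (b ⊗ₜ v) = b ⊗ₜ repAverage ρ K U v := by
  have := hK.finite_quotient hU
  have := Fintype.ofFinite (K ⧸ U.subgroupOf K)
  rw [repAverage_apply _ hK hU, repAverage_apply _ hK hU, finsum_eq_sum_of_fintype,
    finsum_eq_sum_of_fintype]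
  simp only [repBaseChange_tmul]
  have hi : Ring.inverse ((U.relIndex K : ℕ) : B) =
      algebraMap A B (Ring.inverse ((U.relIndex K : ℕ) : A)) := by
    have hu := hA _ (hK.relIndex_ne_zero hU)
    have e : algebraMap A B ((U.relIndex K : ℕ) : A) = ((U.relIndex K : ℕ) : B) := map_natCast _ _
    have hu' : IsUnit ((U.relIndex K : ℕ) : B) := e ▸ hu.map (algebraMap A B)
    refine hu'.mul_left_cancel ?_
    rw [Ring.mul_inverse_cancel _ hu', ← e, ← map_mul, Ring.mul_inverse_cancel _ hu, map_one]
  rw [← TensorProduct.tmul_sum, hi, algebraMap_smul, TensorProduct.tmul_smul]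

/-- The `K`-fixed vectors of a base change are spanned by `K`-fixed vectors. -/
theorem fixedVectors_baseChange (hA : ∀ n : ℕ, n ≠ 0 → IsUnit (n : A)) {ρ : Representation A G V}
    (hρ : IsSmoothRep ρ) {K : Subgroup G} (hK : IsCompactOpen K) :
    fixedVectors (repBaseChange B ρ) K =
      Submodule.span B ((fun v => (1 : B) ⊗ₜ[A] v) '' (fixedVectors ρ K : Set V)) := by
  have hB : ∀ n : ℕ, n ≠ 0 → IsUnit (n : B) := fun n hn => by
    simpa using (hA n hn).map (algebraMap A B)
  apply le_antisymm
  · intro t ht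
    obtain ⟨S, rfl⟩ := TensorProduct.exists_finset t
    classical
    obtain ⟨L, hL, hS⟩ := hρ.exists_common (S.image Prod.snd)
    -- A fixed tensor equals its own average, and averaging acts on each pure tensor through its
    -- second factor.
    rw [← repAverage_eq_self hB _ hK hL.1 ht, map_sum]
    refine Submodule.sum_mem _ fun p hp => ?_
    rw [repAverage_tmul B hA ρ hK hL.1, ← mul_one p.1, ← smul_eq_mul, ← TensorProduct.smul_tmul']
    exact Submodule.smul_mem _ _ (Submodule.subset_span ⟨_, repAverage_mem ρ hK hL.1
      (hS _ (Finset.mem_image_of_mem _ hp)), rfl⟩)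
  · rw [Submodule.span_le]
    rintro _ ⟨v, hv, rfl⟩
    exact tmul_mem_fixedVectors B ρ hv 1

theorem IsAdmissibleRep.baseChange (hA : ∀ n : ℕ, n ≠ 0 → IsUnit (n : A))
    {ρ : Representation A G V} (hρ : IsSmoothRep ρ) (hρ' : IsAdmissibleRep ρ) :
    IsAdmissibleRep (repBaseChange B ρ) := by
  intro K hK
  obtain ⟨s, hs⟩ := (hρ' K hK).fg_top
  have h : fixedVectors (repBaseChange B ρ) K =
      Submodule.span B ((fun v : fixedVectors ρ K => (1 : B) ⊗ₜ[A] (v : V)) '' s) := by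
    rw [fixedVectors_baseChange B hA hρ hK]
    apply le_antisymm
    · rw [Submodule.span_le]
      rintro _ ⟨v, hv, rfl⟩
      have hv' : (⟨v, hv⟩ : fixedVectors ρ K) ∈ Submodule.span A (s : Set (fixedVectors ρ K)) :=
        hs ▸ trivial
      let φ : fixedVectors ρ K →ₗ[A] B ⊗[A] V :=
        (TensorProduct.mk A B V 1).comp (fixedVectors ρ K).subtype
      have h1 := Submodule.mem_map_of_mem (f := φ) hv'
      rw [Submodule.map_span] at h1
      exact Submodule.span_le_restrictScalars A B _ h1
    · refine Submodule.span_mono ?_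
      rintro _ ⟨v, -, rfl⟩
      exact ⟨v, v.2, rfl⟩
  classical
  rw [h]
  exact Module.Finite.iff_fg.2 ⟨(s.image _), by rw [Finset.coe_image]⟩

end Averaging

/-! ### The action of the Hecke algebra with coefficients in a ring. -/

section HeckeOperators

/-- Summation over `G / L` in stages. -/
theorem finsum_quotient_stages {G M : Type*} [Group G] [AddCommMonoid M] {K L : Subgroup G} (hLK : L ≤ K)
    {F : G → M} (hF : ∀ g, ∀ l ∈ L, F (g * l) = F g) (hfin : {q : G ⧸ L | F q.out ≠ 0}.Finite) :
    ∑ᶠ q : G ⧸ L, F q.out =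
      ∑ᶠ q : G ⧸ K, ∑ᶠ r : K ⧸ L.subgroupOf K, F (q.out * (r.out : G)) := by
  let e := Subgroup.quotientEquivProdOfLE hLK
  have he : ∀ p : (G ⧸ K) × (K ⧸ L.subgroupOf K),
      F (e.symm p).out = F (p.1.out * (p.2.out : G)) := by
    rintro ⟨q, r⟩
    have h1 : e.symm (q, r) = QuotientGroup.mk (q.out * (r.out : G)) := by
      conv_lhs => rw [← QuotientGroup.out_eq' r]
      rfl
    -- The chosen representative of a coset of `L` and the product of the chosen representatives
    -- differ by an element of `L`, which `F` does not see.
    have h2 := QuotientGroup.eq.1 ((QuotientGroup.out_eq' (e.symm (q, r))).trans h1)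
    rw [← hF _ _ h2]
    simp
  rw [← finsum_comp_equiv e.symm (f := fun q : G ⧸ L => F q.out), finsum_congr he, finsum_curry]
  refine (hfin.preimage e.symm.injective.injOn).subset fun p hp => ?_
  rw [Function.mem_support, ← he] at hp
  exact hp

variable {G : Type*} [Group G] [TopologicalSpace G]

variable {A : Type*} [CommRing A] {V : Type*} [AddCommGroup V] [Module A V]

/-- Functions on subgroups with the scaling behaviour of a Haar measure. -/
def IsVolume (c : Subgroup G → A) : Prop :=
  ∀ K L : Subgroup G, IsCompactOpen K → IsCompactOpen L → L ≤ K → c K = L.relIndex K * c L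

theorem IsVolume.map {c : Subgroup G → A} (hc : IsVolume c) {B : Type*} [CommRing B]
    (φ : A →+* B) : IsVolume (φ ∘ c) := fun K L hK hL h => by
  simp [hc K L hK hL h]

/-- `K` is a compact open subgroup that fixes `v`, and `f` is right invariant under `K`. -/
structure IsHeckeLevel (ρ : Representation A G V) (f : G → A) (v : V) (K : Subgroup G) : Prop where
  isCompactOpen : IsCompactOpen K
  right_invariant : ∀ g, ∀ k ∈ K, f (g * k) = f g
  mem : v ∈ fixedVectors ρ K

/-- The volume of `K` times the sum of `f(g) g v` over `g ∈ G / K`. -/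
def heckeSum (c : Subgroup G → A) (ρ : Representation A G V) (K : Subgroup G) (f : G → A) (v : V) :
    V :=
  c K • ∑ᶠ q : G ⧸ K, f q.out • ρ q.out v

variable [ContinuousMul G]

theorem finite_cosets_of_hasCompactSupport {K : Subgroup G} (hK : IsOpen (K : Set G))
    {M : Type*} [Zero M] {f : G → M} (hf : HasCompactSupport f) :
    {q : G ⧸ K | f q.out ≠ 0}.Finite := by
  have : DiscreteTopology (G ⧸ K) := QuotientGroup.discreteTopology hK
  have hc : ((QuotientGroup.mk : G → G ⧸ K) '' tsupport f).Finite :=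
    (IsCompact.image hf QuotientGroup.continuous_mk).finite_of_discrete
  refine hc.subset fun q hq => ⟨q.out, subset_tsupport f hq, QuotientGroup.out_eq' q⟩

theorem finite_smul_cosets {K : Subgroup G} (hK : IsOpen (K : Set G)) (ρ : Representation A G V)
    {f : G → A} (hf : HasCompactSupport f) (v : V) :
    {q : G ⧸ K | f q.out • ρ q.out v ≠ 0}.Finite :=
  (finite_cosets_of_hasCompactSupport hK hf).subset fun q hq h => hq (by simp [h])

/-- Refining the level splits each coset of `K` into `[K : L]` cosets with equal summands, and the
volume shrinks by the same factor. Any two levels are then compared through their intersection. -/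
theorem heckeSum_eq_of_le {c : Subgroup G → A} (hc : IsVolume c) {ρ : Representation A G V}
    {f : G → A} (hf : HasCompactSupport f) {v : V} {K L : Subgroup G}
    (hK : IsHeckeLevel ρ f v K) (hL : IsCompactOpen L) (hLK : L ≤ K) :
    heckeSum c ρ L f v = heckeSum c ρ K f v := by
  have hF : ∀ g, ∀ k ∈ K, f (g * k) • ρ (g * k) v = f g • ρ g v := fun g k hk => by
    rw [hK.right_invariant g k hk, map_mul, Module.End.mul_apply, hK.mem k hk]
  have := hK.isCompactOpen.finite_quotient hL.1
  have := Fintype.ofFinite (K ⧸ L.subgroupOf K)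
  have h : ∀ q : G ⧸ K, ∑ᶠ r : K ⧸ L.subgroupOf K, f (q.out * (r.out : G)) •
      ρ (q.out * (r.out : G)) v = L.relIndex K • (f q.out • ρ q.out v) := fun q => by
    rw [finsum_congr fun r : K ⧸ L.subgroupOf K => hF q.out r.out r.out.2,
      finsum_eq_sum_of_fintype, Finset.sum_const, Finset.card_univ, ← Nat.card_eq_fintype_card]
    rfl
  rw [heckeSum, finsum_quotient_stages (F := fun g => f g • ρ g v) hLK
    (fun g l hl => hF g l (hLK hl)) (finite_smul_cosets hL.1 ρ hf v), finsum_congr h,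
    ← smul_finsum' _ (finite_smul_cosets hK.isCompactOpen.1 ρ hf v), heckeSum,
    hc K L hK.isCompactOpen hL hLK, mul_comm, mul_smul, Nat.cast_smul_eq_nsmul]

theorem heckeSum_eq {c : Subgroup G → A} (hc : IsVolume c) {ρ : Representation A G V}
    {f : G → A} (hf : HasCompactSupport f) {v : V} {K L : Subgroup G}
    (hK : IsHeckeLevel ρ f v K) (hL : IsHeckeLevel ρ f v L) :
    heckeSum c ρ K f v = heckeSum c ρ L f v := by
  have h := hK.isCompactOpen.inf hL.isCompactOpen.1
  rw [← heckeSum_eq_of_le hc hf hK h inf_le_left, ← heckeSum_eq_of_le hc hf hL h inf_le_right]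

theorem IsSmoothRep.exists_isHeckeLevel {ρ : Representation A G V} (hρ : IsSmoothRep ρ)
    (f : heckeSpace G A) (v : V) : ∃ K, IsHeckeLevel ρ f.1 v K := by
  obtain ⟨K, hK, hv⟩ := hρ v
  obtain ⟨U, hU, hf⟩ := f.2.2
  refine ⟨K ⊓ U, hK.inf hU, fun g k hk => ?_, fixedVectors_anti ρ inf_le_left hv⟩
  simpa using hf 1 U.one_mem k hk.2 g

theorem heckeSum_add_right {K : Subgroup G} (hK : IsOpen (K : Set G)) (c : Subgroup G → A)
    (ρ : Representation A G V) {f : G → A} (hf : HasCompactSupport f) (v w : V) :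
    heckeSum c ρ K f (v + w) = heckeSum c ρ K f v + heckeSum c ρ K f w := by
  simp only [heckeSum, map_add, smul_add]
  rw [finsum_add_distrib (finite_smul_cosets hK ρ hf v) (finite_smul_cosets hK ρ hf w), smul_add]

theorem heckeSum_add_left {K : Subgroup G} (hK : IsOpen (K : Set G)) (c : Subgroup G → A)
    (ρ : Representation A G V) {f f' : G → A} (hf : HasCompactSupport f)
    (hf' : HasCompactSupport f') (v : V) :
    heckeSum c ρ K (f + f') v = heckeSum c ρ K f v + heckeSum c ρ K f' v := by
  simp only [heckeSum, Pi.add_apply, add_smul]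
  rw [finsum_add_distrib (finite_smul_cosets hK ρ hf v) (finite_smul_cosets hK ρ hf' v), smul_add]

theorem heckeSum_smul_right {K : Subgroup G} (hK : IsOpen (K : Set G)) (c : Subgroup G → A)
    (ρ : Representation A G V) {f : G → A} (hf : HasCompactSupport f) (a : A) (v : V) :
    heckeSum c ρ K f (a • v) = a • heckeSum c ρ K f v := by
  simp only [heckeSum, map_smul]
  rw [smul_comm, smul_finsum' _ (finite_smul_cosets hK ρ hf v)]
  exact congrArg (c K • ·) (finsum_congr fun q => smul_comm _ _ _)

theorem heckeSum_smul_left {K : Subgroup G} (hK : IsOpen (K : Set G)) (c : Subgroup G → A)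
    (ρ : Representation A G V) {f : G → A} (hf : HasCompactSupport f) (a : A) (v : V) :
    heckeSum c ρ K (a • f) v = a • heckeSum c ρ K f v := by
  simp only [heckeSum]
  rw [smul_comm, smul_finsum' _ (finite_smul_cosets hK ρ hf v)]
  simp only [Pi.smul_apply, smul_assoc]

/-- The action of the Hecke algebra on a smooth representation. -/
def heckeOp {c : Subgroup G → A} (hc : IsVolume c) {ρ : Representation A G V}
    (hρ : IsSmoothRep ρ) : heckeSpace G A →ₗ[A] V →ₗ[A] V :=
  LinearMap.mk₂ A (fun f v => heckeSum c ρ (hρ.exists_isHeckeLevel f v).choose f.1 v)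
    (fun f f' v => by
      have h := (hρ.exists_isHeckeLevel f v).choose_spec
      have h' := (hρ.exists_isHeckeLevel f' v).choose_spec
      have h₂ := (hρ.exists_isHeckeLevel (f + f') v).choose_spec
      have hL := h.isCompactOpen.inf (h'.isCompactOpen.inf h₂.isCompactOpen.1).1
      rw [← heckeSum_eq_of_le hc f.2.1 h hL inf_le_left,
        ← heckeSum_eq_of_le hc f'.2.1 h' hL (inf_le_right.trans inf_le_left),
        ← heckeSum_eq_of_le hc (f + f').2.1 h₂ hL (inf_le_right.trans inf_le_right)]
      exact heckeSum_add_left hL.1 c ρ f.2.1 f'.2.1 v)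
    (fun a f v => by
      have h := (hρ.exists_isHeckeLevel f v).choose_spec
      have h₂ := (hρ.exists_isHeckeLevel (a • f) v).choose_spec
      have hL := h.isCompactOpen.inf h₂.isCompactOpen.1
      rw [← heckeSum_eq_of_le hc f.2.1 h hL inf_le_left,
        ← heckeSum_eq_of_le hc (a • f).2.1 h₂ hL inf_le_right]
      exact heckeSum_smul_left hL.1 c ρ f.2.1 a v)
    (fun f v v' => by
      have h := (hρ.exists_isHeckeLevel f v).choose_spec
      have h' := (hρ.exists_isHeckeLevel f v').choose_spec
      have h₂ := (hρ.exists_isHeckeLevel f (v + v')).choose_spec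
      have hL := h.isCompactOpen.inf (h'.isCompactOpen.inf h₂.isCompactOpen.1).1
      rw [← heckeSum_eq_of_le hc f.2.1 h hL inf_le_left,
        ← heckeSum_eq_of_le hc f.2.1 h' hL (inf_le_right.trans inf_le_left),
        ← heckeSum_eq_of_le hc f.2.1 h₂ hL (inf_le_right.trans inf_le_right)]
      exact heckeSum_add_right hL.1 c ρ f.2.1 v v')
    (fun a f v => by
      have h := (hρ.exists_isHeckeLevel f v).choose_spec
      have h₂ := (hρ.exists_isHeckeLevel f (a • v)).choose_spec
      have hL := h.isCompactOpen.inf h₂.isCompactOpen.1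
      rw [← heckeSum_eq_of_le hc f.2.1 h hL inf_le_left,
        ← heckeSum_eq_of_le hc f.2.1 h₂ hL inf_le_right]
      exact heckeSum_smul_right hL.1 c ρ f.2.1 a v)

theorem heckeOp_apply {c : Subgroup G → A} (hc : IsVolume c) {ρ : Representation A G V}
    (hρ : IsSmoothRep ρ) (f : heckeSpace G A) {v : V} {K : Subgroup G}
    (hK : IsHeckeLevel ρ f.1 v K) : heckeOp hc hρ f v = heckeSum c ρ K f.1 v :=
  heckeSum_eq hc f.2.1 (hρ.exists_isHeckeLevel f v).choose_spec hK

/-- Summing over `G / L` in stages, the inner sum over `K / L` is `[K : L]` times the average. Hence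
a Hecke operator of right level `K` is determined by its restriction to `V^K`. -/
theorem heckeOp_repAverage (hA : ∀ n : ℕ, n ≠ 0 → IsUnit (n : A)) {c : Subgroup G → A}
    (hc : IsVolume c) {ρ : Representation A G V} (hρ : IsSmoothRep ρ) (f : heckeSpace G A)
    {K L : Subgroup G} (hK : IsCompactOpen K) (hL : IsCompactOpen L) (hLK : L ≤ K)
    (hf : ∀ g, ∀ k ∈ K, f.1 (g * k) = f.1 g) {v : V} (hv : v ∈ fixedVectors ρ L) :
    heckeOp hc hρ f (repAverage ρ K L v) = heckeOp hc hρ f v := by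
  have h1 : IsHeckeLevel ρ f.1 (repAverage ρ K L v) K := ⟨hK, hf, repAverage_mem ρ hK hL.1 hv⟩
  have h2 : IsHeckeLevel ρ f.1 v L := ⟨hL, fun g k hk => hf g k (hLK hk), hv⟩
  have := hK.finite_quotient hL.1
  have := Fintype.ofFinite (K ⧸ L.subgroupOf K)
  have hu := hA _ (hK.relIndex_ne_zero hL.1)
  have h : ∀ q : G ⧸ K, ∑ᶠ r : K ⧸ L.subgroupOf K, f.1 (q.out * (r.out : G)) •
      ρ (q.out * (r.out : G)) v =
      L.relIndex K • (f.1 q.out • ρ q.out (repAverage ρ K L v)) := fun q => by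
    rw [repAverage_apply ρ hK hL.1, finsum_eq_sum_of_fintype, finsum_eq_sum_of_fintype, map_smul,
      map_sum, smul_comm (f.1 q.out), ← Nat.cast_smul_eq_nsmul A, smul_smul,
      Ring.mul_inverse_cancel _ hu, one_smul, Finset.smul_sum]
    refine Finset.sum_congr rfl fun r _ => ?_
    rw [hf _ _ r.out.2, map_mul, Module.End.mul_apply]
  rw [heckeOp_apply hc hρ f h1, heckeOp_apply hc hρ f h2]
  conv_rhs => rw [heckeSum, finsum_quotient_stages (F := fun g => f.1 g • ρ g v) hLK
    (fun g l hl => by rw [h2.right_invariant g l hl, map_mul, Module.End.mul_apply, hv l hl])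
    (finite_smul_cosets hL.1 ρ f.2.1 v), finsum_congr h,
    ← smul_finsum' _ (finite_smul_cosets hK.1 ρ f.2.1 _)]
  rw [heckeSum, hc K L hK hL hLK, mul_comm, mul_smul, Nat.cast_smul_eq_nsmul]

variable (B : Type*) [CommRing B] [Algebra A B]

theorem heckeOp_baseChange {c : Subgroup G → A} (hc : IsVolume c) {ρ : Representation A G V}
    (hρ : IsSmoothRep ρ) (f : heckeSpace G A) {c' : Subgroup G → B} (hc' : IsVolume c')
    (hcc' : ∀ K, IsCompactOpen K → c' K = algebraMap A B (c K))
    (hρ' : IsSmoothRep (repBaseChange B ρ)) (v : V) :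
    heckeOp hc' hρ' (heckeSpace.map (algebraMap A B) f) (1 ⊗ₜ v) =
      (1 : B) ⊗ₜ[A] heckeOp hc hρ f v := by
  obtain ⟨K, hK⟩ := hρ.exists_isHeckeLevel f v
  have hK' : IsHeckeLevel (repBaseChange B ρ) (heckeSpace.map (algebraMap A B) f).1
      ((1 : B) ⊗ₜ[A] v) K :=
    ⟨hK.isCompactOpen, fun g k hk => congrArg (algebraMap A B) (hK.right_invariant g k hk),
      tmul_mem_fixedVectors B ρ hK.mem 1⟩
  rw [heckeOp_apply hc' hρ' _ hK', heckeOp_apply hc hρ _ hK, heckeSum, heckeSum,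
    hcc' K hK.isCompactOpen, TensorProduct.tmul_smul, algebraMap_smul]
  congr 1
  refine Eq.trans ?_ ((TensorProduct.mk A B V 1).toAddMonoidHom.map_finsum
    (finite_smul_cosets hK.isCompactOpen.1 ρ f.2.1 v)).symm
  refine finsum_congr fun q => ?_
  rw [repBaseChange_tmul]
  simp [heckeSpace.map]

end HeckeOperators

/-! ### The projection onto the vectors fixed by a compact open subgroup. -/

section FixedProjection

variable {G : Type*} [Group G] [TopologicalSpace G] [ContinuousMul G]
  {A : Type*} [CommRing A] {V : Type*} [AddCommGroup V] [Module A V]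

/-- The `K`-orbit of `v` is finite, so its pointwise stabilizer in `K` is open; it is normal because
`K` permutes the orbit. -/
theorem IsSmoothRep.exists_normal_level {ρ : Representation A G V} (hρ : IsSmoothRep ρ)
    {K : Subgroup G} (hK : IsCompactOpen K) (v : V) :
    ∃ L : Subgroup G, IsCompactOpen L ∧ L ≤ K ∧ (L.subgroupOf K).Normal ∧
      ∀ k ∈ K, ρ k v ∈ fixedVectors ρ L := by
  classical
  obtain ⟨U, hU, hv⟩ := hρ v
  have := hK.finite_quotient hU.1
  have := Fintype.ofFinite (K ⧸ U.subgroupOf K)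
  obtain ⟨U', hU', hv'⟩ := hρ.exists_common
    (Finset.univ.image fun q : K ⧸ U.subgroupOf K => ρ (q.out : G) v)
  have hall : ∀ k ∈ K, ρ k v ∈ fixedVectors ρ U' := by
    intro k hk
    have h1 := QuotientGroup.eq.1
      (QuotientGroup.out_eq' (QuotientGroup.mk (⟨k, hk⟩ : K) : K ⧸ U.subgroupOf K))
    have h2 : ρ k v = ρ ((QuotientGroup.mk (⟨k, hk⟩ : K) : K ⧸ U.subgroupOf K).out : G) v := by
      conv_rhs => rw [← hv _ (Subgroup.mem_subgroupOf.1 h1), ← Module.End.mul_apply, ← map_mul]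
      simp
    rw [h2]
    exact hv' _ (Finset.mem_image_of_mem _ (Finset.mem_univ _))
  let L : Subgroup G :=
    { carrier := {m | m ∈ K ∧ ∀ k ∈ K, ρ m (ρ k v) = ρ k v}
      one_mem' := ⟨K.one_mem, fun k _ => by simp⟩
      mul_mem' := by
        rintro a b ⟨ha, ha'⟩ ⟨hb, hb'⟩
        exact ⟨K.mul_mem ha hb, fun k hk => by
          rw [map_mul, Module.End.mul_apply, hb' k hk, ha' k hk]⟩
      inv_mem' := by
        rintro a ⟨ha, ha'⟩
        refine ⟨K.inv_mem ha, fun k hk => ?_⟩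
        conv_lhs => rw [← ha' k hk, ← Module.End.mul_apply, ← map_mul]
        simp }
  have hLK : L ≤ K := fun m hm => hm.1
  have hsub : K ⊓ U' ≤ L := fun m hm => ⟨hm.1, fun k hk => hall k hk m hm.2⟩
  have hLo : IsOpen (L : Set G) := Subgroup.isOpen_mono hsub (hK.inf hU'.1).1
  refine ⟨L, by simpa [inf_eq_right.2 hLK] using hK.inf hLo, hLK, ⟨?_⟩, fun k hk m hm => hm.2 k hk⟩
  rintro ⟨m, hm⟩ hmL ⟨g, hg⟩
  refine ⟨K.mul_mem (K.mul_mem hg hm) (K.inv_mem hg), fun k hk => ?_⟩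
  have h1 := (Subgroup.mem_subgroupOf.1 hmL).2 (g⁻¹ * k) (K.mul_mem (K.inv_mem hg) hk)
  change ρ (g * m * g⁻¹) (ρ k v) = ρ k v
  calc ρ (g * m * g⁻¹) (ρ k v) = ρ g (ρ m (ρ (g⁻¹ * k) v)) := by
        simp only [map_mul, Module.End.mul_apply]
    _ = ρ k v := by
        rw [h1, ← Module.End.mul_apply, ← map_mul]
        simp

/-- Normality makes `K / L` a group, and replacing `v` by `k v` is a right translation of the
summation index in it. -/
theorem repAverage_map (ρ : Representation A G V) {K L : Subgroup G} (hK : IsCompactOpen K)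
    (hL : IsOpen (L : Set G)) (hn : (L.subgroupOf K).Normal) {v : V} (hv : v ∈ fixedVectors ρ L)
    {k : G} (hk : k ∈ K) : repAverage ρ K L (ρ k v) = repAverage ρ K L v := by
  have := hK.finite_quotient hL
  have := Fintype.ofFinite (K ⧸ L.subgroupOf K)
  rw [repAverage_apply ρ hK hL, repAverage_apply ρ hK hL, finsum_eq_sum_of_fintype,
    finsum_eq_sum_of_fintype]
  congr 1
  rw [← Equiv.sum_comp (Equiv.mulRight (QuotientGroup.mk (⟨k, hk⟩ : K) : K ⧸ L.subgroupOf K))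
    fun q => ρ (q.out : G) v]
  refine Finset.sum_congr rfl fun q _ => ?_
  have h1 : (QuotientGroup.mk (q.out * ⟨k, hk⟩) : K ⧸ L.subgroupOf K) =
      QuotientGroup.mk (q * QuotientGroup.mk (⟨k, hk⟩ : K) : K ⧸ L.subgroupOf K).out := by
    rw [QuotientGroup.out_eq', QuotientGroup.mk_mul, QuotientGroup.out_eq']
  have h2 := hv _ (Subgroup.mem_subgroupOf.1 (QuotientGroup.eq.1 h1))
  rw [Equiv.coe_mulRight, ← Module.End.mul_apply, ← map_mul]
  conv_lhs => rw [← h2, ← Module.End.mul_apply, ← map_mul]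
  simp

theorem heckeOp_map (hA : ∀ n : ℕ, n ≠ 0 → IsUnit (n : A)) {c : Subgroup G → A}
    (hc : IsVolume c) {ρ : Representation A G V} (hρ : IsSmoothRep ρ) (f : heckeSpace G A)
    {K : Subgroup G} (hK : IsCompactOpen K) (hf : ∀ g, ∀ k ∈ K, f.1 (g * k) = f.1 g) {k : G}
    (hk : k ∈ K) (v : V) : heckeOp hc hρ f (ρ k v) = heckeOp hc hρ f v := by
  obtain ⟨L, hL, hLK, hn, hv⟩ := hρ.exists_normal_level hK v
  have hv1 : v ∈ fixedVectors ρ L := by simpa using hv 1 K.one_mem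
  rw [← heckeOp_repAverage hA hc hρ f hK hL hLK hf (hv k hk),
    ← heckeOp_repAverage hA hc hρ f hK hL hLK hf hv1, repAverage_map ρ hK hL.1 hn hv1 hk]

/-- The indicator function of a compact open subgroup. -/
def heckeIndicator (A : Type*) [CommRing A] {K : Subgroup G} (hK : IsCompactOpen K) :
    heckeSpace G A :=
  ⟨(K : Set G).indicator 1, hK.2.of_isClosed_subset (isClosed_tsupport _)
    (closure_minimal Set.support_indicator_subset (Subgroup.isClosed_of_isOpen K hK.1)), K, hK.1, fun a ha b hb g => by
      have : a * g * b ∈ (K : Set G) ↔ g ∈ (K : Set G) := by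
        simp only [SetLike.mem_coe, K.mul_mem_cancel_right hb, K.mul_mem_cancel_left ha]
      by_cases h : g ∈ (K : Set G)
      · rw [Set.indicator_of_mem h, Set.indicator_of_mem (this.2 h)]; rfl
      · rw [Set.indicator_of_notMem h, Set.indicator_of_notMem (mt this.1 h)]⟩

theorem heckeIndicator_mul {K : Subgroup G} (hK : IsCompactOpen K) (g : G) {k : G} (hk : k ∈ K) :
    (heckeIndicator A hK).1 (g * k) = (heckeIndicator A hK).1 g := by
  change (K : Set G).indicator 1 (g * k) = (K : Set G).indicator 1 g
  by_cases h : g ∈ (K : Set G)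
  · rw [Set.indicator_of_mem h, Set.indicator_of_mem (K.mul_mem h hk)]; rfl
  · rw [Set.indicator_of_notMem h, Set.indicator_of_notMem (mt (K.mul_mem_cancel_right hk).1 h)]

theorem heckeOp_heckeIndicator {c : Subgroup G → A} (hc : IsVolume c)
    {ρ : Representation A G V} (hρ : IsSmoothRep ρ) {K : Subgroup G} (hK : IsCompactOpen K)
    {v : V} (hv : v ∈ fixedVectors ρ K) : heckeOp hc hρ (heckeIndicator A hK) v = c K • v := by
  have h : IsHeckeLevel ρ (heckeIndicator A hK).1 v K :=
    ⟨hK, fun g _ hk => heckeIndicator_mul hK g hk, hv⟩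
  rw [heckeOp_apply hc hρ _ h, heckeSum, finsum_eq_single _ (QuotientGroup.mk 1 : G ⧸ K)]
  · have h1 : (QuotientGroup.mk 1 : G ⧸ K).out ∈ K := by
      simpa using QuotientGroup.eq.1 (QuotientGroup.out_eq' (QuotientGroup.mk 1 : G ⧸ K)).symm
    have h2 : (heckeIndicator A hK).1 (QuotientGroup.mk 1 : G ⧸ K).out = 1 :=
      Set.indicator_of_mem h1 _
    rw [h2, one_smul, hv _ h1]
  · intro q hq
    have h2 : (heckeIndicator A hK).1 q.out = 0 := Set.indicator_of_notMem (fun h1 => hq (by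
      rw [← QuotientGroup.out_eq' q, eq_comm, QuotientGroup.eq]
      simpa using h1)) _
    rw [h2, zero_smul]

/-- The projection onto the vectors fixed by a compact open subgroup. -/
theorem IsSmoothRep.exists_projection (hA : ∀ n : ℕ, n ≠ 0 → IsUnit (n : A))
    {c : Subgroup G → A} (hc : IsVolume c) {ρ : Representation A G V} (hρ : IsSmoothRep ρ)
    {K : Subgroup G} (hK : IsCompactOpen K) (hcK : IsUnit (c K)) :
    ∃ e : V →ₗ[A] fixedVectors ρ K, (∀ v : fixedVectors ρ K, e v = v) ∧
      ∀ k ∈ K, ∀ v, e (ρ k v) = e v := by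
  have hf : ∀ g, ∀ k ∈ K, (heckeIndicator A hK).1 (g * k) = (heckeIndicator A hK).1 g :=
    fun g _ hk => heckeIndicator_mul hK g hk
  -- The projector is the normalized indicator of `K`. Unlike `repAverage`, whose auxiliary level
  -- must fix the vector, it is one linear map on all of `V`.
  have hmem : ∀ v, (Ring.inverse (c K) • heckeOp hc hρ (heckeIndicator A hK)) v ∈
      fixedVectors ρ K := by
    intro v
    obtain ⟨L, hL, hLK, -, hv⟩ := hρ.exists_normal_level hK v
    have hv1 : v ∈ fixedVectors ρ L := by simpa using hv 1 K.one_mem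
    rw [LinearMap.smul_apply, ← heckeOp_repAverage hA hc hρ _ hK hL hLK hf hv1,
      heckeOp_heckeIndicator hc hρ hK (repAverage_mem ρ hK hL.1 hv1)]
    exact Submodule.smul_mem _ _ (Submodule.smul_mem _ _ (repAverage_mem ρ hK hL.1 hv1))
  refine ⟨LinearMap.codRestrict _ _ hmem, fun v => Subtype.ext ?_, fun k hk v => Subtype.ext ?_⟩
  · rw [LinearMap.codRestrict_apply, LinearMap.smul_apply, heckeOp_heckeIndicator hc hρ hK v.2,
      smul_smul, Ring.inverse_mul_cancel _ hcK, one_smul]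
  · rw [LinearMap.codRestrict_apply, LinearMap.codRestrict_apply, LinearMap.smul_apply,
      LinearMap.smul_apply, heckeOp_map hA hc hρ _ hK hf hk]

end FixedProjection

/-! ### Tensors that represent Hecke operators, and dual bases. -/

section Characters

variable {k : Type*} [Field k] {V W : Type*} [AddCommGroup V] [Module k V]
  [AddCommGroup W] [Module k W]

/-- The finite rank operators attached to a pairing: `v ⊗ w` acts by `u ↦ β(u, w) v`. -/
def rankOp (β : V →ₗ[k] W →ₗ[k] k) : V ⊗[k] W →ₗ[k] V →ₗ[k] V :=
  TensorProduct.lift (LinearMap.mk₂ k (fun v w => (β.flip w).smulRight v)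
    (fun v v' w => by ext u; simp)
    (fun a v w => by ext u; simp [smul_smul, mul_comm])
    (fun v w w' => by ext u; simp [add_smul])
    (fun a v w => by ext u; simp [mul_smul]))

theorem rankOp_tmul (β : V →ₗ[k] W →ₗ[k] k) (v u : V) (w : W) :
    rankOp β (v ⊗ₜ w) u = β u w • v := by
  simp [rankOp]

/-- Write the tensor as `∑ bᵢ ⊗ wᵢ` with `bᵢ` from a basis of `V`. If its operator is zero, the
coordinates `β(u, wᵢ)` vanish for all `u`, so every `wᵢ` is zero. -/
theorem rankOp_injective {β : V →ₗ[k] W →ₗ[k] k} (hβ : β.SeparatingRight) :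
    Function.Injective (rankOp β) := by
  rw [← LinearMap.ker_eq_bot, LinearMap.ker_eq_bot']
  intro t ht
  classical
  let b := Module.Basis.ofVectorSpace k V
  obtain ⟨w, rfl⟩ : ∃ w : Module.Basis.ofVectorSpaceIndex k V →₀ W,
      (TensorProduct.equivFinsuppOfBasisLeft b).symm w = t := ⟨_, LinearEquiv.symm_apply_apply _ t⟩
  rw [TensorProduct.equivFinsuppOfBasisLeft_symm_apply] at ht ⊢
  have h : ∀ i u, β u (w i) = 0 := by
    intro i u
    have h1 := congrArg (b.repr · i) (LinearMap.congr_fun ht u)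
    by_cases hi : w i = 0
    · rw [hi, map_zero]
    · simpa [Finsupp.sum, rankOp_tmul, Finsupp.finsetSum_apply, Finsupp.single_apply,
        Finset.sum_ite_eq, hi] using h1
  refine Finset.sum_eq_zero fun i _ => ?_
  rw [hβ (w i) (h i)]
  exact TensorProduct.tmul_zero _ _

variable {G : Type*} [Group G] [TopologicalSpace G] [ContinuousMul G]

/-- Hecke operators are of finite rank: an expansion in terms of vectors whose Gram matrix is
invertible. -/
theorem rankOp_eq_heckeOp (hk : ∀ n : ℕ, n ≠ 0 → IsUnit (n : k)) {c : Subgroup G → k}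
    (hc : IsVolume c) {ρ : Representation k G V} (hρ : IsSmoothRep ρ) (f : heckeSpace G k)
    {K : Subgroup G} (hK : IsCompactOpen K) (hf : ∀ g, ∀ k ∈ K, f.1 (g * k) = f.1 g)
    {β : V →ₗ[k] W →ₗ[k] k} {ι : Type*} [Fintype ι] [DecidableEq ι] (m : ι → V) (n : ι → W)
    (hm : fixedVectors ρ K ≤ Submodule.span k (Set.range m))
    (hn : ∀ j, ∀ g ∈ K, ∀ v, β (ρ g v) (n j) = β v (n j))
    (hdet : (Matrix.of fun i j => β (m i) (n j)).det ≠ 0) :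
    rankOp β (∑ i, ∑ j, (Matrix.of fun i j => β (m i) (n j))⁻¹ j i • (heckeOp hc hρ f (m i) ⊗ₜ n j)) =
      heckeOp hc hρ f := by
  set M := Matrix.of fun i j => β (m i) (n j) with hM
  set T := rankOp β (∑ i, ∑ j, M⁻¹ j i • (heckeOp hc hρ f (m i) ⊗ₜ n j)) with hT
  have happ : ∀ u, T u = ∑ i, ∑ j, M⁻¹ j i • (β u (n j) • heckeOp hc hρ f (m i)) := fun u => by
    simp [hT, LinearMap.sum_apply, rankOp_tmul]
  -- On `m l` the coefficients `β(m l, n j)` form row `l` of `M`, and the sum over `j` is the entry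
  -- of `M M⁻¹`.
  have hgen : ∀ l, T (m l) = heckeOp hc hρ f (m l) := by
    intro l
    have h1 : ∀ i, ∑ j, M⁻¹ j i • (β (m l) (n j) • heckeOp hc hρ f (m i)) =
        (M * M⁻¹) l i • heckeOp hc hρ f (m i) := fun i => by
      rw [Matrix.mul_apply, Finset.sum_smul]
      exact Finset.sum_congr rfl fun j _ => by rw [smul_smul, mul_comm]; rfl
    rw [happ, Finset.sum_congr rfl fun i _ => h1 i,
      Matrix.mul_nonsing_inv _ (isUnit_iff_ne_zero.2 hdet)]
    simp [Matrix.one_apply]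
  have hfix : ∀ u ∈ fixedVectors ρ K, T u = heckeOp hc hρ f u := fun u hu =>
    LinearMap.eqOn_span (s := Set.range m) (by rintro _ ⟨l, rfl⟩; exact hgen l) (hm hu)
  ext v
  obtain ⟨L, hL, hLK, -, hv⟩ := hρ.exists_normal_level hK v
  have hv1 : v ∈ fixedVectors ρ L := by simpa using hv 1 K.one_mem
  -- Both operators factor through the average over `K`, so agreement on `V^K` is enough.
  rw [← heckeOp_repAverage hk hc hρ f hK hL hLK hf hv1,
    ← hfix _ (repAverage_mem ρ hK hL.1 hv1), apply_repAverage hk ρ hK hL.1]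
  intro g hg
  simp only [happ, hn _ g hg]

/-- The linear form on the Hecke algebra attached to a bilinear form `Z`: it is the value of `Z` on
the tensors that represent the Hecke operators. -/
theorem exists_linearForm {c : Subgroup G → k} (hc : IsVolume c) {ρ : Representation k G V}
    (hρ : IsSmoothRep ρ) {β : V →ₗ[k] W →ₗ[k] k} (hβ : β.SeparatingRight)
    (hfin : ∀ f, ∃ t, rankOp β t = heckeOp hc hρ f) (Z : V →ₗ[k] W →ₗ[k] k) :
    ∃ J : heckeSpace G k →ₗ[k] k, ∀ f t, rankOp β t = heckeOp hc hρ f →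
      J f = TensorProduct.lift Z t := by
  refine ⟨TensorProduct.lift Z ∘ₗ (LinearEquiv.ofInjective _ (rankOp_injective hβ)).symm.toLinearMap ∘ₗ
    (heckeOp hc hρ).codRestrict _ fun f => hfin f, fun f t ht => ?_⟩
  have : (LinearEquiv.ofInjective _ (rankOp_injective hβ)).symm
      ((heckeOp hc hρ).codRestrict (LinearMap.range (rankOp β)) (fun f => hfin f) f) = t := by
    rw [LinearEquiv.symm_apply_eq]
    exact Subtype.ext ht.symm
  simp [this]

theorem contragredient_apply_map {ρ : Representation k G V} {K : Subgroup G}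
    {l : contragredient ρ} (hl : l ∈ fixedVectors (contragredientRep ρ) K) {g : G} (hg : g ∈ K)
    (v : V) : (l : Module.Dual k V) (ρ g v) = (l : Module.Dual k V) v := by
  have h1 := congrArg (fun x : contragredient ρ => (x : Module.Dual k V) v)
    (hl g⁻¹ (K.inv_mem hg))
  simpa [contragredientRep, Representation.dual_apply, Module.Dual.transpose_apply] using h1

theorem contragredient_ext (hk : ∀ n : ℕ, n ≠ 0 → IsUnit (n : k)) {ρ : Representation k G V}
    (hρ : IsSmoothRep ρ) {K : Subgroup G} (hK : IsCompactOpen K) {l l' : contragredient ρ}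
    (hl : l ∈ fixedVectors (contragredientRep ρ) K)
    (hl' : l' ∈ fixedVectors (contragredientRep ρ) K)
    (h : ∀ v ∈ fixedVectors ρ K, (l : Module.Dual k V) v = (l' : Module.Dual k V) v) : l = l' := by
  refine Subtype.ext (LinearMap.ext fun v => ?_)
  obtain ⟨L, hL, hv⟩ := hρ v
  rw [← apply_repAverage hk ρ hK hL.1 _ v fun g hg => contragredient_apply_map hl hg v,
    ← apply_repAverage hk ρ hK hL.1 _ v fun g hg => contragredient_apply_map hl' hg v]
  exact h _ (repAverage_mem ρ hK hL.1 hv)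

/-- The extension is the composite of `φ` with the `K`-invariant projection `V → V^K`. -/
theorem exists_contragredient_extension (hk : ∀ n : ℕ, n ≠ 0 → IsUnit (n : k))
    {c : Subgroup G → k} (hc : IsVolume c) {ρ : Representation k G V} (hρ : IsSmoothRep ρ)
    {K : Subgroup G} (hK : IsCompactOpen K) (hcK : IsUnit (c K))
    (φ : Module.Dual k (fixedVectors ρ K)) :
    ∃ l ∈ fixedVectors (contragredientRep ρ) K,
      ∀ v : fixedVectors ρ K, (l : Module.Dual k V) v = φ v := by
  obtain ⟨e, he, heK⟩ := hρ.exists_projection hk hc hK hcK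
  have hfix : φ.comp e ∈ fixedVectors ρ.dual K := fun g hg => by
    ext v
    simp [Representation.dual_apply, Module.Dual.transpose_apply, heK _ (K.inv_mem hg)]
  exact ⟨⟨φ.comp e, K, hK.1, hfix⟩, fun g hg => Subtype.ext (hfix g hg), fun v => by simp [he]⟩

/-- For an admissible smooth representation, `V^K` and `(V^∨)^K` have dual bases. -/
theorem nonempty_dualBases (hk : ∀ n : ℕ, n ≠ 0 → IsUnit (n : k)) {c : Subgroup G → k}
    (hc : IsVolume c) {ρ : Representation k G V} (hρ : IsSmoothRep ρ) (hρ' : IsAdmissibleRep ρ)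
    {K : Subgroup G} (hK : IsCompactOpen K) (hcK : IsUnit (c K)) : Nonempty (DualBases ρ K) := by
  have := hρ' K hK
  let r : fixedVectors (contragredientRep ρ) K →ₗ[k] Module.Dual k (fixedVectors ρ K) :=
    { toFun := fun l => ((l : contragredient ρ) : Module.Dual k V).comp (fixedVectors ρ K).subtype
      map_add' := fun _ _ => rfl
      map_smul' := fun _ _ => rfl }
  -- Restriction identifies `(V^∨)^K` with the dual of the finite-dimensional space `V^K`, so an
  -- ordinary dual basis can be transported.
  have hr : Function.Bijective r := by
    refine ⟨fun l l' h => Subtype.ext (contragredient_ext hk hρ hK l.2 l'.2 fun v hv =>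
      LinearMap.congr_fun h ⟨v, hv⟩), fun φ => ?_⟩
    obtain ⟨l, hl, h⟩ := exists_contragredient_extension hk hc hρ hK hcK φ
    exact ⟨⟨l, hl⟩, LinearMap.ext h⟩
  let b := Module.finBasis k (fixedVectors ρ K)
  refine ⟨⟨_, b, b.dualBasis.map (LinearEquiv.ofBijective r hr).symm, fun i j => ?_⟩⟩
  have h1 : r ((b.dualBasis.map (LinearEquiv.ofBijective r hr).symm) j) = b.dualBasis j := by
    rw [Module.Basis.map_apply]
    exact LinearEquiv.apply_symm_apply (LinearEquiv.ofBijective r hr) _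
  have h2 := LinearMap.congr_fun h1 (b i)
  rw [Module.Basis.dualBasis_apply_self] at h2
  exact h2.trans (by simp)

end Characters

/-! ### Extension of scalars along an embedding into `ℂ`. -/

section Twist

variable {G : Type*} [Group G] {k : Type*} [Field k] (τ : k →+* ℂ)
  {V W : Type*} [AddCommGroup V] [Module k V] [AddCommGroup W] [Module k W]

theorem twistRep_of (ρ : Representation k G V) (g : G) (v : V) :
    twistRep τ ρ g (Twist.of τ v) = Twist.of τ (ρ g v) := by
  let _ : Algebra k ℂ := τ.toAlgebra
  exact repBaseChange_tmul ℂ ρ g 1 v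

theorem twistPairing_of (β : V →ₗ[k] W →ₗ[k] k) (v : V) (w : W) :
    twistPairing τ β (Twist.of τ v) (Twist.of τ w) = τ (β v w) := by
  let _ : Algebra k ℂ := τ.toAlgebra
  refine (pairingBaseChange_tmul ℂ β 1 1 v w).trans ?_
  rw [one_mul, one_mul]
  rfl

theorem Twist.of_sum {ι : Type*} (s : Finset ι) (v : ι → V) :
    Twist.of τ (∑ i ∈ s, v i) = ∑ i ∈ s, Twist.of τ (v i) := by
  let _ : Algebra k ℂ := τ.toAlgebra
  exact TensorProduct.tmul_sum _ _ _

theorem Twist.of_smul (a : k) (v : V) : Twist.of τ (a • v) = τ a • Twist.of τ v := by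
  let _ : Algebra k ℂ := τ.toAlgebra
  refine (TensorProduct.tmul_smul a (1 : ℂ) v).trans ?_
  exact (algebraMap_smul ℂ a ((1 : ℂ) ⊗ₜ[k] v)).symm

theorem Twist.hom_ext {M : Type*} [AddCommGroup M] [Module ℂ M] {φ ψ : Twist τ V →ₗ[ℂ] M}
    (h : ∀ v, φ (Twist.of τ v) = ψ (Twist.of τ v)) : φ = ψ := by
  let _ : Algebra k ℂ := τ.toAlgebra
  refine LinearMap.ext fun t => ?_
  induction t using TensorProduct.induction_on with
  | zero => rw [map_zero, map_zero]
  | tmul b v =>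
    have e : (b ⊗ₜ[k] v : Twist τ V) = b • Twist.of τ v :=
      (TensorProduct.smul_tmul' b (1 : ℂ) v).trans (by rw [smul_eq_mul, mul_one]) |>.symm
    rw [e, map_smul, map_smul, h]
  | add s t hs ht => rw [map_add, map_add, hs, ht]

theorem Twist.of_injective : Function.Injective (Twist.of τ : V → Twist τ V) := by
  let _ : Algebra k ℂ := τ.toAlgebra
  exact (Module.FaithfullyFlat.tensorProduct_mk_injective (A := k) (B := ℂ) V)

end Twist

/-! ### Spherical characters as values of the period on a tensor. -/

section SphericalCharacters

variable {G : Type*} [Group G] [TopologicalSpace G] [ContinuousMul G] [MeasurableSpace G]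

/-- Dual bases have Gram matrix `1`, so the Gram expansion of `σ(f)` is `∑ σ(f) φᵢ ⊗ φⁱ`; by
injectivity of `rankOp` this is `t`. In particular the level and the bases chosen in the definition
do not matter. -/
theorem sphericalCharacter_eq {V : Type*} [AddCommGroup V] [Module ℂ V] {μ : Measure G}
    {c : Subgroup G → ℂ} (hc : IsVolume c) (hcμ : ∀ K, IsCompactOpen K → c K = μ.real K)
    (hc0 : ∀ K, IsCompactOpen K → c K ≠ 0) {σ : Representation ℂ G V} (hσ : IsSmoothRep σ)
    (hσ' : IsAdmissibleRep σ) (Z : V →ₗ[ℂ] contragredient σ →ₗ[ℂ] ℂ) (f : heckeSpace G ℂ)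
    {t : V ⊗[ℂ] contragredient σ}
    (ht : rankOp (contragredient σ).subtype.flip t = heckeOp hc hσ f) :
    sphericalCharacter μ σ Z f = TensorProduct.lift Z t := by
  have hℂ : ∀ n : ℕ, n ≠ 0 → IsUnit (n : ℂ) := fun n hn => by simpa using hn
  -- This excludes the default value `0` in the definition of the spherical character.
  have hex : ∃ K : Subgroup G, IsCompactOpen K ∧ IsBiInvariant K f.1 ∧ Nonempty (DualBases σ K) := by
    obtain ⟨K, hK, -⟩ := hσ 0
    obtain ⟨U, hU, hf⟩ := f.2.2
    exact ⟨K ⊓ U, hK.inf hU, fun a ha b hb g => hf a ha.2 b hb.2 g,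
      nonempty_dualBases hℂ hc hσ hσ' (hK.inf hU) (hc0 _ (hK.inf hU)).isUnit⟩
  rw [sphericalCharacter, dif_pos hex]
  generalize hex.choose_spec.2.2.some = b
  obtain ⟨hK, hf, -⟩ := hex.choose_spec
  revert b
  generalize hex.choose = K at *
  intro b
  have hf' : ∀ g, ∀ k ∈ K, f.1 (g * k) = f.1 g := fun g k hk => by
    simpa using hf 1 K.one_mem k hk g
  set m : Fin b.rank → V := fun i => b.basis i with hm
  set n : Fin b.rank → contragredient σ := fun i => b.dualBasis i with hn
  have hone : (Matrix.of fun i j => (contragredient σ).subtype.flip (m i) (n j)) = 1 := by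
    ext i j
    rw [Matrix.one_apply]
    exact b.pairing i j
  have hspan : fixedVectors σ K ≤ Submodule.span ℂ (Set.range m) := by
    intro v hv
    have h1 := Submodule.mem_map_of_mem (f := (fixedVectors σ K).subtype)
      (b.basis.mem_span (⟨v, hv⟩ : fixedVectors σ K))
    rwa [Submodule.map_span, ← Set.range_comp] at h1
  have hinv : ∀ j, ∀ g ∈ K, ∀ v, (contragredient σ).subtype.flip (σ g v) (n j) =
      (contragredient σ).subtype.flip v (n j) := by
    intro j g hg v
    exact contragredient_apply_map (b.dualBasis j).2 hg v
  have hT := rankOp_eq_heckeOp hℂ hc hσ f hK hf' m n hspan hinv (by rw [hone]; simp)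
  have hsep : (contragredient σ).subtype.flip.SeparatingRight := fun l hl =>
    Subtype.ext (LinearMap.ext hl)
  rw [← rankOp_injective hsep (hT.trans ht.symm), hone, inv_one, map_sum]
  refine Finset.sum_congr rfl fun i _ => ?_
  have hact : heckeAction μ σ K f.1 (m i) = heckeOp hc hσ f (m i) := by
    rw [heckeOp_apply hc hσ f ⟨hK, hf', (b.basis i).2⟩, heckeSum, hcμ K hK]
    rfl
  rw [map_sum, Finset.sum_eq_single i]
  · rw [Matrix.one_apply_eq, one_smul, TensorProduct.lift.tmul, ← hact]
  · intro j _ hj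
    rw [Matrix.one_apply_ne hj, zero_smul, map_zero]
  · simp

variable {Y : Type*} [TopologicalSpace Y] [MeasurableSpace Y] [MulAction Gᵐᵒᵖ Y] {ν : Measure Y}
  (P : PlancherelDecomposition.{w} G ν) (y₀ : Y)
  {k : Type*} [Field k] {V W : Type*} [AddCommGroup V] [Module k V] [AddCommGroup W] [Module k W]

/-- A tensor representing `ρ(f)` is carried by `v ⊗ w ↦ v ⊗ β_τ(·, w)` to one representing the
operator of `τ ∘ f` on the twist, and the hypothesis on `Z` matches the two periods on pure tensors.
-/
theorem sphericalCharacter_twist (hk : ∀ n : ℕ, n ≠ 0 → IsUnit (n : k)) {μ : Measure G}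
    {c : Subgroup G → k} (hc : IsVolume c) (hc0 : ∀ K, IsCompactOpen K → c K ≠ 0) (τ : k →+* ℂ)
    (hcμ : ∀ K, IsCompactOpen K → τ (c K) = μ.real K)
    {ρ : Representation k G V} {ρ' : Representation k G W} (hρ : IsSmoothRep ρ)
    (hρa : IsAdmissibleRep ρ) (hρ' : IsSmoothRep ρ') {β : V →ₗ[k] W →ₗ[k] k}
    (hβ : IsInvariantPairing ρ ρ' β) {Z : V →ₗ[k] W →ₗ[k] k}
    (hZ : ∀ v w, τ (Z v w) = P.pairingPeriod y₀ (twistRep τ ρ) (twistPairing τ β)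
      (Twist.of τ v) (Twist.of τ w))
    (f : heckeSpace G k) {t : V ⊗[k] W} (ht : rankOp β t = heckeOp hc hρ f) :
    τ (TensorProduct.lift Z t) = sphericalCharacter μ (twistRep τ ρ)
      (P.localPeriod y₀ (twistRep τ ρ)) (heckeSpace.map τ f) := by
  classical
  have hσ : IsSmoothRep (twistRep τ ρ) := by
    let _ : Algebra k ℂ := τ.toAlgebra
    exact hρ.baseChange ℂ
  have hσ' : IsAdmissibleRep (twistRep τ ρ) := by
    let _ : Algebra k ℂ := τ.toAlgebra
    exact IsAdmissibleRep.baseChange ℂ hk hρ hρa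
  -- This excludes the default value `0` of `pairingPeriod`.
  have hD : ∀ w, (twistPairing τ β).flip (Twist.of τ w) ∈ contragredient (twistRep τ ρ) := by
    intro w
    obtain ⟨K, hK, hw⟩ := hρ' w
    refine ⟨K, hK.1, fun g hg => Twist.hom_ext τ fun v => ?_⟩
    have h1 := hβ g⁻¹ v w
    rw [hw _ (K.inv_mem hg)] at h1
    simp only [Representation.dual_apply, Module.Dual.transpose_apply, LinearMap.comp_apply,
      LinearMap.flip_apply, twistRep_of, twistPairing_of, h1]
  obtain ⟨S, rfl⟩ := TensorProduct.exists_finset t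
  have key := sphericalCharacter_eq (hc.map τ) (μ := μ) hcμ
    (fun K hK => (map_ne_zero τ).2 (hc0 K hK)) hσ hσ' (P.localPeriod y₀ (twistRep τ ρ))
    (heckeSpace.map τ f)
    (t := ∑ p ∈ S, Twist.of τ p.1 ⊗ₜ[ℂ] (⟨_, hD p.2⟩ : contragredient (twistRep τ ρ))) ?_
  · rw [key, map_sum, map_sum, map_sum]
    refine Finset.sum_congr rfl fun p _ => ?_
    rw [TensorProduct.lift.tmul, TensorProduct.lift.tmul, hZ, PlancherelDecomposition.pairingPeriod,
      dif_pos (hD p.2)]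
  · refine Twist.hom_ext τ fun v => ?_
    have h1 : heckeOp (hc.map τ) hσ (heckeSpace.map τ f) (Twist.of τ v) =
        Twist.of τ (heckeOp hc hρ f v) := by
      let _ : Algebra k ℂ := τ.toAlgebra
      exact heckeOp_baseChange ℂ hc hρ f (hc.map τ) (fun K _ => rfl) hσ v
    rw [h1, ← ht, map_sum, map_sum, LinearMap.sum_apply, LinearMap.sum_apply, Twist.of_sum]
    refine Finset.sum_congr rfl fun p _ => ?_
    rw [rankOp_tmul, rankOp_tmul, Twist.of_smul, ← twistPairing_of]
    rfl

end SphericalCharacters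

/-! ### Gram matrices on the fibres of a family. -/

section Fibers

variable {G : Type*} [Group G] {A : Type*} [CommRing A] {V W : Type*} [AddCommGroup V] [Module A V]
  [AddCommGroup W] [Module A W] (κ : Type*) [Field κ] [Algebra A κ]

theorem IsInvariantPairing.baseChange {ρ : Representation A G V} {ρ' : Representation A G W}
    {β : V →ₗ[A] W →ₗ[A] A} (hβ : IsInvariantPairing ρ ρ' β) :
    IsInvariantPairing (repBaseChange κ ρ) (repBaseChange κ ρ') (pairingBaseChange κ β) := by
  intro g s t
  induction s with
  | zero => simp
  | add s s' hs hs' => simp only [map_add, LinearMap.add_apply, hs, hs']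
  | tmul a v =>
    induction t with
    | zero => simp
    | add t t' ht ht' => simp only [map_add, ht, ht']
    | tmul b w =>
      rw [repBaseChange_tmul, repBaseChange_tmul, pairingBaseChange_tmul, pairingBaseChange_tmul,
        hβ]

variable [TopologicalSpace G] [ContinuousMul G]

/-- If the fibre of an invariant pairing is non-degenerate, then there are finitely many `K`-fixed
vectors with invertible Gram matrix that span the `K`-fixed vectors of the fibre. -/
theorem exists_gram (hA : ∀ n : ℕ, n ≠ 0 → IsUnit (n : A)) {ρ : Representation A G V}
    {ρ' : Representation A G W} (hρ : IsSmoothRep ρ) (hρa : IsAdmissibleRep ρ)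
    (hρ' : IsSmoothRep ρ') {β : V →ₗ[A] W →ₗ[A] A} (hβ : IsInvariantPairing ρ ρ' β)
    (hnd : (pairingBaseChange κ β).SeparatingLeft) {K : Subgroup G} (hK : IsCompactOpen K) :
    ∃ (d : ℕ) (m : Fin d → V) (n : Fin d → W), (∀ i, m i ∈ fixedVectors ρ K) ∧
      (∀ j, n j ∈ fixedVectors ρ' K) ∧
      fixedVectors (repBaseChange κ ρ) K =
        Submodule.span κ (Set.range fun i => (1 : κ) ⊗ₜ[A] m i) ∧
      algebraMap A κ (Matrix.of fun i j => β (m i) (n j)).det ≠ 0 := by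
  have hκ : ∀ n : ℕ, n ≠ 0 → IsUnit (n : κ) := fun n hn => by
    simpa using (hA n hn).map (algebraMap A κ)
  have hfin : Module.Finite κ (fixedVectors (repBaseChange κ ρ) K) :=
    IsAdmissibleRep.baseChange κ hA hρ hρa K hK
  obtain ⟨b, hb, hspan, hli⟩ := exists_linearIndependent κ
    ((fun v => (1 : κ) ⊗ₜ[A] v) '' (fixedVectors ρ K : Set V))
  rw [← fixedVectors_baseChange κ hA hρ hK] at hspan
  have hbfin : Finite b := by
    have hmem : ∀ i : b, (i : κ ⊗[A] V) ∈ fixedVectors (repBaseChange κ ρ) K := fun i =>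
      hspan ▸ Submodule.subset_span i.2
    have : LinearIndependent κ fun i : b => (⟨i, hmem i⟩ : fixedVectors (repBaseChange κ ρ) K) :=
      LinearIndependent.of_comp (fixedVectors (repBaseChange κ ρ) K).subtype hli
    exact this.finite
  obtain ⟨d, ⟨e⟩⟩ := Finite.exists_equiv_fin b
  choose m hmK hm using fun i : Fin d => hb (e.symm i).2
  have hrange : Set.range (fun i => (1 : κ) ⊗ₜ[A] m i) = b := by
    have : (fun i => (1 : κ) ⊗ₜ[A] m i) = Subtype.val ∘ e.symm := funext hm
    rw [this, e.symm.surjective.range_comp, Subtype.range_coe]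
  have hli' : LinearIndependent κ fun i => (1 : κ) ⊗ₜ[A] m i := by
    have : (fun i => (1 : κ) ⊗ₜ[A] m i) = Subtype.val ∘ e.symm := funext hm
    rw [this]
    exact hli.comp _ e.symm.injective
  let r : fixedVectors ρ' K → Fin d → κ := fun n i => algebraMap A κ (β (m i) n)
  -- If the columns `(β(mᵢ, n))ᵢ` did not span, a linear relation `φ` among the rows would give a
  -- `K`-fixed vector `u` of the fibre orthogonal to all `K`-fixed `n`. By averaging, `u` is
  -- orthogonal to everything, which contradicts non-degeneracy and the independence of the `mᵢ`.
  have hr : Submodule.span κ (Set.range r) = ⊤ := by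
    by_contra hne
    obtain ⟨φ, hφ, hle⟩ := Submodule.exists_le_ker_of_lt_top _ (lt_top_iff_ne_top.2 hne)
    have hφ' : ∀ x, φ x = ∑ i, x i * φ (Pi.single i 1) := fun x => by
      conv_lhs => rw [pi_eq_sum_univ' x]
      simp
    set u := ∑ i, φ (Pi.single i 1) • ((1 : κ) ⊗ₜ[A] m i) with hu
    have hun : ∀ n ∈ fixedVectors ρ' K, pairingBaseChange κ β u (1 ⊗ₜ n) = 0 := by
      intro n hn
      have h1 : φ (r ⟨n, hn⟩) = 0 := hle (Submodule.subset_span ⟨_, rfl⟩)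
      rw [hφ'] at h1
      rw [hu, map_sum, LinearMap.sum_apply, ← h1]
      refine Finset.sum_congr rfl fun i _ => ?_
      rw [map_smul, LinearMap.smul_apply, pairingBaseChange_tmul, smul_eq_mul, one_mul, one_mul,
        mul_comm]
    have huK : u ∈ fixedVectors (repBaseChange κ ρ) K :=
      Submodule.sum_mem _ fun i _ => Submodule.smul_mem _ _ (tmul_mem_fixedVectors κ ρ (hmK i) 1)
    have hu0 : u = 0 := by
      refine hnd u fun w => ?_
      obtain ⟨L, hL, hw⟩ := hρ'.baseChange κ w
      rw [← apply_repAverage hκ (repBaseChange κ ρ') hK hL.1 (pairingBaseChange κ β u) w]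
      · have h2 := repAverage_mem (repBaseChange κ ρ') hK hL.1 hw
        rw [fixedVectors_baseChange κ hA hρ' hK] at h2
        refine (Submodule.span_le (p := LinearMap.ker (pairingBaseChange κ β u))).2 ?_ h2
        rintro _ ⟨n, hn, rfl⟩
        exact hun n hn
      · intro k hk
        conv_lhs => rw [← huK k hk, hβ.baseChange κ]
    refine hφ (LinearMap.ext fun x => ?_)
    rw [hφ' x, LinearMap.zero_apply]
    refine Finset.sum_eq_zero fun i _ => ?_
    rw [Fintype.linearIndependent_iff.1 hli' _ (hu.symm.trans hu0) i, mul_zero]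
  -- A basis of `κ^d` among the columns: it has exactly `d` members, so the Gram matrix is square
  -- and invertible over `κ`.
  obtain ⟨b', hb', hspan', hli2⟩ := exists_linearIndependent κ (Set.range r)
  rw [hr] at hspan'
  let B := Module.Basis.mk hli2 (by rw [Subtype.range_coe, hspan'])
  have := hli2.finite
  have := Fintype.ofFinite b'
  have hcard : Fintype.card b' = d := by
    rw [← Module.finrank_eq_card_basis B, Module.finrank_fin_fun]
  let e' := Fintype.equivFinOfCardEq hcard
  choose n hn using fun j : Fin d => hb' (e'.symm j).2
  refine ⟨d, m, fun j => n j, hmK, fun j => (n j).2, by rw [hrange, hspan], ?_⟩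
  have hcol : LinearIndependent κ fun j => r (n j) := by
    have : (fun j => r (n j)) = Subtype.val ∘ e'.symm := funext hn
    rw [this]
    exact hli2.comp _ e'.symm.injective
  rw [RingHom.map_det]
  have hunit : IsUnit ((algebraMap A κ).mapMatrix (Matrix.of fun i j => β (m i) (n j))) :=
    Matrix.linearIndependent_cols_iff_isUnit.1 hcol
  exact ((Matrix.isUnit_iff_isUnit_det _).1 hunit).ne_zero

/-- The Gram matrix expansion of Hecke operators on a fibre. -/
theorem rankOp_eq_heckeOp_baseChange (hA : ∀ n : ℕ, n ≠ 0 → IsUnit (n : A))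
    {ρ : Representation A G V} {ρ' : Representation A G W} (hρκ : IsSmoothRep (repBaseChange κ ρ))
    {β : V →ₗ[A] W →ₗ[A] A} (hβ : IsInvariantPairing ρ ρ' β) {c : Subgroup G → κ}
    (hc : IsVolume c) (f : heckeSpace G κ) {K : Subgroup G} (hK : IsCompactOpen K)
    (hf : ∀ g, ∀ k ∈ K, f.1 (g * k) = f.1 g) {d : ℕ} {m : Fin d → V} {n : Fin d → W}
    (hn : ∀ j, n j ∈ fixedVectors ρ' K)
    (hm : fixedVectors (repBaseChange κ ρ) K ≤
        Submodule.span κ (Set.range fun i => (1 : κ) ⊗ₜ[A] m i))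
    (hdet : algebraMap A κ (Matrix.of fun i j => β (m i) (n j)).det ≠ 0) :
    rankOp (pairingBaseChange κ β) (∑ i, ∑ j,
      ((algebraMap A κ).mapMatrix (Matrix.of fun i j => β (m i) (n j)))⁻¹ j i •
        (heckeOp hc hρκ f (1 ⊗ₜ m i) ⊗ₜ[κ] ((1 : κ) ⊗ₜ[A] n j))) = heckeOp hc hρκ f := by
  have hκ : ∀ n : ℕ, n ≠ 0 → IsUnit (n : κ) := fun n hn => by
    simpa using (hA n hn).map (algebraMap A κ)
  have hM : (Matrix.of fun i j => pairingBaseChange κ β ((1 : κ) ⊗ₜ[A] m i) ((1 : κ) ⊗ₜ[A] n j)) =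
      (algebraMap A κ).mapMatrix (Matrix.of fun i j => β (m i) (n j)) := by
    ext i j
    simp [pairingBaseChange_tmul]
  have h := rankOp_eq_heckeOp hκ hc hρκ f hK hf (β := pairingBaseChange κ β)
    (fun i => (1 : κ) ⊗ₜ[A] m i) (fun j => (1 : κ) ⊗ₜ[A] n j) hm ?_ ?_
  · rwa [hM] at h
  · intro j g hg v
    conv_rhs => rw [← hβ.baseChange κ g, tmul_mem_fixedVectors κ ρ' (hn j) 1 g hg]
  · rwa [hM, ← RingHom.map_det]

end Fibers

/-! ### Rational volumes and levels of Hecke functions. -/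

section HeckeLevels

variable {G : Type*} [Group G] [TopologicalSpace G]

theorem isVolume_ratCast {q : Subgroup G → ℚ} (hq : IsVolume q) (κ : Type*) [Field κ]
    [CharZero κ] : IsVolume fun K => (q K : κ) :=
  hq.map (Rat.castHom κ)

variable [ContinuousMul G]

theorem exists_rightInvariant {k : Type*} [CommRing k] (f : heckeSpace G k) {K₀ : Subgroup G}
    (hK₀ : IsCompactOpen K₀) :
    ∃ K : Subgroup G, IsCompactOpen K ∧ ∀ g, ∀ k ∈ K, f.1 (g * k) = f.1 g := by
  obtain ⟨U, hU, hf⟩ := f.2.2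
  exact ⟨K₀ ⊓ U, hK₀.inf hU, fun g k hk => by simpa using hf 1 U.one_mem k hk.2 g⟩

end HeckeLevels

/-! ### Spreading out the Gram expansion from a point to a neighbourhood. -/

section SpanNearby

variable {G : Type*} [Group G] [TopologicalSpace G] [ContinuousMul G]
  {R : Type u} [CommRing R] {V : Type u} [AddCommGroup V] [Module R V]

/-- A spanning set of the `K`-fixed vectors in the fibre at `x`, consisting of `K`-fixed vectors,
spans the `K`-fixed vectors in the fibres near `x`. -/
theorem exists_span_nearby (hR : ∀ n : ℕ, n ≠ 0 → IsUnit (n : R)) {c : Subgroup G → R}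
    (hc : IsVolume c) {ρ : Representation R G V} (hρ : IsSmoothRep ρ) (hρa : IsAdmissibleRep ρ)
    {K : Subgroup G} (hK : IsCompactOpen K) (hcK : IsUnit (c K)) (x : PrimeSpectrum R)
    {ι : Type*} (m : ι → V) (hmK : ∀ i, m i ∈ fixedVectors ρ K)
    (hspan : fixedVectors (repBaseChange (resField x) ρ) K =
      Submodule.span (resField x) (Set.range fun i => (1 : resField x) ⊗ₜ[R] m i)) :
    ∃ g : R, g ∉ x.asIdeal ∧ ∀ y : PrimeSpectrum R, g ∉ y.asIdeal →
      fixedVectors (repBaseChange (resField y) ρ) K ≤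
        Submodule.span (resField y) (Set.range fun i => (1 : resField y) ⊗ₜ[R] m i) := by
  have := hρa K hK
  obtain ⟨e, he, -⟩ := hρ.exists_projection hR hc hK hcK
  let m' : ι → fixedVectors ρ K := fun i => ⟨m i, hmK i⟩
  obtain ⟨g, hgx, hg⟩ := exists_smul_mem_span x m' (by
    rw [eq_top_iff]
    rintro t -
    -- `V^K` is a direct summand of `V` by the projection `e`, so it embeds in the fibre. Nakayama's
    -- lemma can thus be applied to the finite module `V^K` in place of `V`.
    have hinj : Function.Injective ((fixedVectors ρ K).subtype.baseChange (resField x)) := by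
      refine Function.LeftInverse.injective (g := e.baseChange (resField x)) fun t => ?_
      rw [← LinearMap.comp_apply, ← LinearMap.baseChange_comp]
      have : e ∘ₗ (fixedVectors ρ K).subtype = LinearMap.id := LinearMap.ext he
      rw [this, LinearMap.baseChange_id, LinearMap.id_apply]
    have h1 : (fixedVectors ρ K).subtype.baseChange (resField x) t ∈
        Submodule.span (resField x) (Set.range fun i => (1 : resField x) ⊗ₜ[R] m i) := by
      rw [← hspan]
      induction t with
      | zero => rw [map_zero]; exact Submodule.zero_mem _
      | tmul a v => exact tmul_mem_fixedVectors _ ρ v.2 a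
      | add s t hs ht => rw [map_add]; exact Submodule.add_mem _ hs ht
    have h2 : (Set.range fun i => (1 : resField x) ⊗ₜ[R] m i) =
        (fixedVectors ρ K).subtype.baseChange (resField x) ''
          Set.range fun i => (1 : resField x) ⊗ₜ[R] m' i := by
      rw [← Set.range_comp]
      rfl
    rw [h2, ← Submodule.map_span] at h1
    obtain ⟨s, hs, hst⟩ := h1
    rwa [← hinj hst])
  refine ⟨g, hgx, fun y hgy => ?_⟩
  rw [fixedVectors_baseChange (resField y) hR hρ hK, Submodule.span_le]
  rintro _ ⟨v, hv, rfl⟩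
  have h1 := Submodule.mem_map_of_mem (f := (TensorProduct.mk R (resField y) V 1).comp
    (fixedVectors ρ K).subtype) (hg ⟨v, hv⟩)
  rw [Submodule.map_span, ← Set.range_comp] at h1
  have h2 := Submodule.span_le_restrictScalars R (resField y) _ h1
  have hne : algebraMap R (resField y) g ≠ 0 := fun h =>
    hgy (Ideal.algebraMap_residueField_eq_zero.1 h)
  have h3 : (1 : resField y) ⊗ₜ[R] v = (algebraMap R (resField y) g)⁻¹ •
      ((TensorProduct.mk R (resField y) V 1).comp (fixedVectors ρ K).subtype) (g • ⟨v, hv⟩) := by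
    rw [map_smul, ← algebraMap_smul (resField y) g, smul_smul, inv_mul_cancel₀ hne, one_smul]
    rfl
  change (1 : resField y) ⊗ₜ[R] v ∈ Submodule.span (resField y) _
  rw [h3]
  exact Submodule.smul_mem _ _ h2

variable {W : Type u} [AddCommGroup W] [Module R W]

/-- The spherical characters in a family are given by fractions locally. -/
theorem exists_local_character (hR : ∀ n : ℕ, n ≠ 0 → IsUnit (n : R)) {c : Subgroup G → R}
    (hc : IsVolume c) (hcu : ∀ K, IsCompactOpen K → IsUnit (c K)) {ρ : Representation R G V}
    {ρ' : Representation R G W} (hρ : IsSmoothRep ρ) (hρa : IsAdmissibleRep ρ)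
    (hρ' : IsSmoothRep ρ') {B : V →ₗ[R] W →ₗ[R] R} (hB : IsInvariantPairing ρ ρ' B)
    {S : Set (PrimeSpectrum R)} {U : Opens (PrimeSpectrum R)} (hU : S ⊆ U)
    (Z : V →ₗ[R] W →ₗ[R] regularFunctions R U)
    (Zx : ∀ x : PrimeSpectrum R, Fiber x V →ₗ[resField x] Fiber x W →ₗ[resField x] resField x)
    (hZ : ∀ (x : PrimeSpectrum R) (hx : x ∈ S), ∀ v w,
      evalAt x (hU hx) (Z v w) = Zx x (1 ⊗ₜ v) (1 ⊗ₜ w))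
    {J : ∀ x : PrimeSpectrum R, heckeSpace G (resField x) →ₗ[resField x] resField x}
    {cx : ∀ x : PrimeSpectrum R, Subgroup G → resField x} (hcx : ∀ x ∈ S, IsVolume (cx x))
    (hccx : ∀ x ∈ S, ∀ K, IsCompactOpen K → cx x K = algebraMap R (resField x) (c K))
    (hJ : ∀ (x : PrimeSpectrum R) (hx : x ∈ S), ∀ f t,
      rankOp (pairingBaseChange (resField x) B) t =
        heckeOp (hcx x hx) (hρ.baseChange (resField x)) f → J x f = TensorProduct.lift (Zx x) t)
    (f : heckeSpace G R) {x : PrimeSpectrum R} (hx : x ∈ S)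
    (hnd : (pairingBaseChange (resField x) B).Nondegenerate) :
    ∃ s r : R, s ∉ x.asIdeal ∧ ∀ y ∈ S, s ∉ y.asIdeal →
      J y (heckeSpace.map (algebraMap R (resField y)) f) * algebraMap R (resField y) s =
        algebraMap R (resField y) r := by
  obtain ⟨K₀, hK₀, -⟩ := hρ 0
  obtain ⟨K, hK, hf⟩ := exists_rightInvariant f hK₀
  obtain ⟨d, m, n, hmK, hnK, hspan, hdet⟩ := exists_gram (resField x) hR hρ hρa hρ' hB hnd.1 hK
  obtain ⟨g, hgx, hg⟩ := exists_span_nearby hR hc hρ hρa hK (hcu K hK) x m hmK hspan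
  set M := Matrix.of fun i j => B (m i) (n j) with hM
  -- The Gram expansion with `M⁻¹` replaced by the adjugate, which has entries in `R`; its value at
  -- a good point is `det M` times the character.
  let s : regularFunctions R U := ∑ i, ∑ j,
    algebraMap R (regularFunctions R U) (M.adjugate j i) * Z (heckeOp hc hρ f (m i)) (n j)
  obtain ⟨a, h, hhx, ha⟩ := exists_local_fraction s x (hU hx)
  -- Away from `g = 0` the `mᵢ` still span, away from `det M = 0` the Gram matrix is invertible, and
  -- `h` is a local denominator of the section `s`.
  refine ⟨g * M.det * h, g * a, fun hmem => ?_, fun y hy hsy => ?_⟩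
  · rcases x.isPrime.mem_or_mem hmem with h1 | h1
    · rcases x.isPrime.mem_or_mem h1 with h2 | h2
      exacts [hgx h2, hdet (Ideal.algebraMap_residueField_eq_zero.2 h2)]
    · exact hhx h1
  have hgy : g ∉ y.asIdeal := fun h1 => hsy (Ideal.mul_mem_right _ _ (Ideal.mul_mem_right _ _ h1))
  have hhy : h ∉ y.asIdeal := fun h1 => hsy (Ideal.mul_mem_left _ _ h1)
  have hdety : algebraMap R (resField y) M.det ≠ 0 := fun h1 =>
    hsy (Ideal.mul_mem_right _ _ (Ideal.mul_mem_left _ _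
      (Ideal.algebraMap_residueField_eq_zero.1 h1)))
  have hT := rankOp_eq_heckeOp_baseChange (resField y) hR (hρ.baseChange _) hB (hcx y hy)
    (heckeSpace.map (algebraMap R (resField y)) f) hK
    (fun g k hk => congrArg (algebraMap R (resField y)) (hf g k hk)) hnK (hg y hgy) hdety
  have key : algebraMap R (resField y) M.det *
      J y (heckeSpace.map (algebraMap R (resField y)) f) = evalHom y (hU hy) s := by
    rw [hJ y hy _ _ hT]
    simp only [s, map_sum, map_mul, Finset.mul_sum, evalHom_algebraMap, map_smul, smul_eq_mul]
    refine Finset.sum_congr rfl fun i _ => Finset.sum_congr rfl fun j _ => ?_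
    rw [heckeOp_baseChange (resField y) hc hρ f (hcx y hy) (hccx y hy), TensorProduct.lift.tmul,
      ← hZ y hy, evalHom_apply, ← mul_assoc]
    congr 1
    rw [← hM, Matrix.inv_def, Matrix.smul_apply, smul_eq_mul, ← mul_assoc, RingHom.map_det,
      Ring.mul_inverse_cancel _ (by rw [← RingHom.map_det]; exact hdety.isUnit), one_mul,
      ← RingHom.map_adjugate]
    rfl
  rw [map_mul, map_mul, map_mul, ← ha y (hU hy) hhy, ← key]
  ring

end SpanNearby

/-! ### Rational spherical characters at a point. -/

section CharacterFamilies

variable {G : Type*} [Group G] [TopologicalSpace G] [ContinuousMul G] [MeasurableSpace G]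
  {Y : Type*} [TopologicalSpace Y] [MeasurableSpace Y] [MulAction Gᵐᵒᵖ Y] {ν : Measure Y}
  (P : PlancherelDecomposition.{w} G ν) (y₀ : Y)
  {R : Type u} [CommRing R] {V W : Type u} [AddCommGroup V] [Module R V]
  [AddCommGroup W] [Module R W]

/-- A rational local period at `x` yields a rational spherical character at `x`. -/
theorem exists_isCharacterAt (hR : ∀ n : ℕ, n ≠ 0 → IsUnit (n : R)) {μ : Measure G}
    {q : Subgroup G → ℚ} (hq : IsVolume q) (hq0 : ∀ K, IsCompactOpen K → q K ≠ 0)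
    (hqμ : ∀ K, IsCompactOpen K → (q K : ℝ) = μ.real K) {ρ : Representation R G V}
    {ρ' : Representation R G W} (hρ : IsSmoothRep ρ) (hρa : IsAdmissibleRep ρ)
    (hρ' : IsSmoothRep ρ') {B : V →ₗ[R] W →ₗ[R] R} (hB : IsInvariantPairing ρ ρ' B)
    {H : Subgroup G} (x : PrimeSpectrum R) [CharZero (resField x)]
    (hnd : (pairingBaseChange (resField x) B).Nondegenerate)
    {Zx : Fiber x V →ₗ[resField x] Fiber x W →ₗ[resField x] resField x}
    (hZ : IsPeriodAt P y₀ H ρ ρ' B x Zx) :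
    ∃ J : heckeSpace G (resField x) →ₗ[resField x] resField x, IsCharacterAt P y₀ μ ρ x J ∧
      ∀ f t, rankOp (pairingBaseChange (resField x) B) t =
        heckeOp (isVolume_ratCast hq (resField x)) (hρ.baseChange (resField x)) f →
        J f = TensorProduct.lift Zx t := by
  have hκ : ∀ n : ℕ, n ≠ 0 → IsUnit (n : resField x) := fun n hn => by simpa using hn
  have hfin : ∀ f, ∃ t, rankOp (pairingBaseChange (resField x) B) t =
      heckeOp (isVolume_ratCast hq (resField x)) (hρ.baseChange (resField x)) f := by
    intro f
    obtain ⟨K₀, hK₀, -⟩ := hρ 0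
    obtain ⟨K, hK, hf⟩ := exists_rightInvariant f hK₀
    obtain ⟨d, m, n, -, hn, hspan, hdet⟩ := exists_gram (resField x) hR hρ hρa hρ' hB hnd.1 hK
    exact ⟨_, rankOp_eq_heckeOp_baseChange (resField x) hR (hρ.baseChange _) hB _ f hK hf hn
      hspan.le hdet⟩
  obtain ⟨J, hJ⟩ := exists_linearForm (isVolume_ratCast hq (resField x))
    (hρ.baseChange (resField x)) hnd.2 hfin Zx
  refine ⟨J, fun τ hτ f => ?_, hJ⟩
  obtain ⟨t, ht⟩ := hfin f
  rw [hJ f t ht]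
  refine sphericalCharacter_twist P y₀ hκ (isVolume_ratCast hq (resField x))
    (fun K hK => Rat.cast_ne_zero.2 (hq0 K hK)) τ (fun K hK => ?_) (hρ.baseChange (resField x))
    (IsAdmissibleRep.baseChange _ hR hρ hρa) (hρ'.baseChange (resField x))
    (hB.baseChange (resField x)) (fun v w => hZ.2 τ hτ v w) f ht
  rw [map_ratCast, ← hqμ K hK]
  norm_cast

/-- A single good embedding determines `J`, since field embeddings are injective. -/
theorem IsCharacterAt.unique {μ : Measure G} {ρ : Representation R G V} {x : PrimeSpectrum R}
    (hx : (goodEmbeddings P x ρ).Nonempty)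
    {J J' : heckeSpace G (resField x) →ₗ[resField x] resField x}
    (hJ : IsCharacterAt P y₀ μ ρ x J) (hJ' : IsCharacterAt P y₀ μ ρ x J') : J = J' := by
  obtain ⟨τ, hτ⟩ := hx
  exact LinearMap.ext fun f => τ.injective ((hJ τ hτ f).trans (hJ' τ hτ f).symm)

end CharacterFamilies

/-! ### Separating subrepresentations of a dual. -/

section Separation

variable {G : Type*} [Group G] [TopologicalSpace G] [ContinuousMul G]
  {k : Type*} [Field k] {V W : Type*} [AddCommGroup V] [Module k V] [AddCommGroup W] [Module k W]

theorem IsInvariantPairing.apply_repAverage_right (hk : ∀ n : ℕ, n ≠ 0 → IsUnit (n : k))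
    {ρ : Representation k G V} {ρ' : Representation k G W} {β : V →ₗ[k] W →ₗ[k] k}
    (hβ : IsInvariantPairing ρ ρ' β) {K L : Subgroup G} (hK : IsCompactOpen K)
    (hL : IsOpen (L : Set G)) {v : V} (hv : v ∈ fixedVectors ρ K) (w : W) :
    β v (repAverage ρ' K L w) = β v w :=
  apply_repAverage hk ρ' hK hL (β v) w fun g hg => by
    conv_lhs => rw [← hv g hg, hβ]

theorem IsInvariantPairing.apply_repAverage_left (hk : ∀ n : ℕ, n ≠ 0 → IsUnit (n : k))
    {ρ : Representation k G V} {ρ' : Representation k G W} {β : V →ₗ[k] W →ₗ[k] k}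
    (hβ : IsInvariantPairing ρ ρ' β) {K L : Subgroup G} (hK : IsCompactOpen K)
    (hL : IsOpen (L : Set G)) (v : V) {w : W} (hw : w ∈ fixedVectors ρ' K) :
    β (repAverage ρ K L v) w = β v w :=
  apply_repAverage hk ρ hK hL (β.flip w) v fun g hg => by
    rw [LinearMap.flip_apply, LinearMap.flip_apply]
    conv_lhs => rw [← hw g hg, hβ]

/-- In an invariant pairing of an admissible smooth representation with a smooth representation that
embeds into its dual, a subrepresentation of the latter that separates the former is everything. -/
theorem eq_top_of_separating (hk : ∀ n : ℕ, n ≠ 0 → IsUnit (n : k))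
    {ρ : Representation k G V} {ρ' : Representation k G W} (hρ : IsSmoothRep ρ)
    (hρa : IsAdmissibleRep ρ) (hρ' : IsSmoothRep ρ') {β : V →ₗ[k] W →ₗ[k] k}
    (hβ : IsInvariantPairing ρ ρ' β) (hβr : β.SeparatingRight) (N : Submodule k W)
    (hN : ∀ g, ∀ w ∈ N, ρ' g w ∈ N) (hsep : ∀ v, (∀ w ∈ N, β v w = 0) → v = 0) : N = ⊤ := by
  rw [eq_top_iff]
  rintro l -
  obtain ⟨K, hK, hl⟩ := hρ' l
  have := hρa K hK
  let r : W →ₗ[k] Module.Dual k (fixedVectors ρ K) := (β.comp (fixedVectors ρ K).subtype).flip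
  -- By averaging, the `K`-fixed part of `N` still separates `V^K`. As `V^K` is finite-dimensional,
  -- `N^K` then induces all linear forms on it, including the one given by `l`.
  let D := (N ⊓ fixedVectors ρ' K).map r
  have hco : D.dualCoannihilator = ⊥ := by
    rw [eq_bot_iff]
    intro v hv
    rw [Submodule.mem_dualCoannihilator] at hv
    refine Subtype.ext (hsep v fun w hw => ?_)
    obtain ⟨L, hL, hwL⟩ := hρ' w
    have hmem : repAverage ρ' K L w ∈ N := by
      have := hK.finite_quotient hL.1
      have := Fintype.ofFinite (K ⧸ L.subgroupOf K)
      rw [repAverage_apply _ hK hL.1, finsum_eq_sum_of_fintype]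
      exact Submodule.smul_mem _ _ (Submodule.sum_mem _ fun q _ => hN _ _ hw)
    rw [← hβ.apply_repAverage_right hk hK hL.1 v.2 w]
    exact hv _ (Submodule.mem_map_of_mem
      (Submodule.mem_inf.2 ⟨hmem, repAverage_mem ρ' hK hL.1 hwL⟩))
  have hD : D = ⊤ := by
    rw [← Subspace.dualCoannihilator_dualAnnihilator_eq (W := D), hco,
      Submodule.dualAnnihilator_bot]
  obtain ⟨l', hl'N, hl'⟩ : r l ∈ D := hD ▸ trivial
  have h : l - l' = 0 := hβr _ fun v => by
    obtain ⟨L, hL, hv⟩ := hρ v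
    have hfix : l - l' ∈ fixedVectors ρ' K := sub_mem hl hl'N.2
    rw [← hβ.apply_repAverage_left hk hK hL.1 v hfix, map_sub, sub_eq_zero]
    exact (LinearMap.congr_fun hl' ⟨_, repAverage_mem ρ hK hL.1 hv⟩).symm
  rw [sub_eq_zero.1 h]
  exact hl'N.1

end Separation

/-! ### The contragredient as a dual family over a field. -/

section Contragredient

variable {G : Type*} [Group G] [TopologicalSpace G] [ContinuousMul G]
  {k : Type*} [Field k] {V : Type*} [AddCommGroup V] [Module k V]

theorem contragredientRep_apply (ρ : Representation k G V) (g : G) (l : contragredient ρ) (v : V) :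
    (contragredientRep ρ g l : Module.Dual k V) v = (l : Module.Dual k V) (ρ g⁻¹ v) := by
  simp [contragredientRep, Representation.dual_apply, Module.Dual.transpose_apply]

/-- The evaluation pairing between `V` and its contragredient. -/
def contragredientPairing (ρ : Representation k G V) : V →ₗ[k] contragredient ρ →ₗ[k] k :=
  (contragredient ρ).subtype.flip

theorem contragredientPairing_apply (ρ : Representation k G V) (v : V) (l : contragredient ρ) :
    contragredientPairing ρ v l = (l : Module.Dual k V) v := rfl

theorem IsSmoothRep.contragredientRep {ρ : Representation k G V} (hρ : IsSmoothRep ρ) :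
    IsSmoothRep (contragredientRep ρ) := by
  intro l
  obtain ⟨K, hK, -⟩ := hρ 0
  obtain ⟨U, hU, hl⟩ := l.2
  exact ⟨K ⊓ U, hK.inf hU, fun g hg => Subtype.ext (hl g hg.2)⟩

theorem IsAdmissibleRep.contragredientRep (hk : ∀ n : ℕ, n ≠ 0 → IsUnit (n : k))
    {c : Subgroup G → k} (hc : IsVolume c) (hc0 : ∀ K, IsCompactOpen K → c K ≠ 0)
    {ρ : Representation k G V} (hρ : IsSmoothRep ρ) (hρa : IsAdmissibleRep ρ) :
    IsAdmissibleRep (contragredientRep ρ) := by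
  intro K hK
  obtain ⟨b⟩ := nonempty_dualBases hk hc hρ hρa hK (hc0 K hK).isUnit
  exact Module.Finite.of_basis b.dualBasis

theorem contragredientPairing_separatingRight (ρ : Representation k G V) :
    (contragredientPairing ρ).SeparatingRight := fun _ h => Subtype.ext (LinearMap.ext h)

theorem isInvariantPairing_contragredient (ρ : Representation k G V) :
    IsInvariantPairing ρ (contragredientRep ρ) (contragredientPairing ρ) := by
  intro g v l
  change (contragredientRep ρ g l : Module.Dual k V) (ρ g v) = (l : Module.Dual k V) v
  rw [contragredientRep_apply, ← Module.End.mul_apply, ← map_mul]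
  simp

/-- Any non-zero `l` generates: by `hsep` the translates of `l` separate `V`, so
`eq_top_of_separating` applies to the submodule that they span. -/
theorem contragredient_finite (hk : ∀ n : ℕ, n ≠ 0 → IsUnit (n : k))
    {ρ : Representation k G V} (hρ : IsSmoothRep ρ) (hρa : IsAdmissibleRep ρ)
    (hsep : ∀ l : contragredient ρ, l ≠ 0 → ∀ v,
      (∀ g, (l : Module.Dual k V) (ρ g v) = 0) → v = 0) :
    Module.Finite (MonoidAlgebra k G) (contragredientRep ρ).asModule := by
  by_cases hex : ∃ l : contragredient ρ, l ≠ 0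
  · obtain ⟨l, hl⟩ := hex
    let e := (contragredientRep ρ).asModuleEquiv.symm
    let N : Submodule (MonoidAlgebra k G) (contragredientRep ρ).asModule :=
      Submodule.span (MonoidAlgebra k G) {e l}
    let N' : Submodule k (contragredient ρ) := (N.restrictScalars k).comap e.toLinearMap
    have hmap : ∀ g, ∀ l ∈ N', contragredientRep ρ g l ∈ N' := fun g l' hl' => by
      change e (contragredientRep ρ g l') ∈ N
      rw [Representation.asModuleEquiv_symm_map_rho]
      exact N.smul_mem _ hl'
    have hlN : e l ∈ N := Submodule.subset_span (Set.mem_singleton _)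
    have htop : N' = ⊤ := eq_top_of_separating (W := contragredient ρ)
      (ρ' := contragredientRep ρ) hk hρ hρa hρ.contragredientRep
      (isInvariantPairing_contragredient ρ) (contragredientPairing_separatingRight ρ) N' hmap fun v hv =>
      hsep l hl v fun g => by
        have h1 := hv _ (hmap g⁻¹ l hlN)
        rwa [contragredientPairing_apply, contragredientRep_apply, inv_inv] at h1
    refine ⟨⟨{e l}, ?_⟩⟩
    rw [Finset.coe_singleton, eq_top_iff]
    rintro t -
    have h1 : e.symm t ∈ N' := htop ▸ trivial
    change e (e.symm t) ∈ N at h1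
    rwa [LinearEquiv.apply_symm_apply] at h1
  · push Not at hex
    have : Subsingleton (contragredientRep ρ).asModule :=
      subsingleton_of_forall_eq 0 fun t => hex t
    infer_instance

/-- The vectors of the twist killed by all translates of the extended form `φ` are a
subrepresentation, hence zero or everything. The second case would give `l = 0`; the first gives `v
= 0` because `V` embeds in its twist. -/
theorem separating_of_isIrreducible_twist {κ : Type*} [Field κ] [Algebra k κ] (τ : κ →+* ℂ)
    {ρ : Representation k G V} (hirr : (twistRep τ (repBaseChange κ ρ)).IsIrreducible)
    (l : contragredient ρ) (hl : l ≠ 0) (v : V) (hv : ∀ g, (l : Module.Dual k V) (ρ g v) = 0) :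
    v = 0 := by
  let σ := twistRep τ (repBaseChange κ ρ)
  let j : V → Twist τ (κ ⊗[k] V) := fun u => Twist.of τ ((1 : κ) ⊗ₜ[k] u)
  let φ : Twist τ (κ ⊗[k] V) →ₗ[ℂ] ℂ :=
    (twistPairing τ (pairingBaseChange κ (contragredientPairing ρ))).flip
      (Twist.of τ ((1 : κ) ⊗ₜ[k] l))
  have hφ : ∀ u, φ (j u) = τ (algebraMap k κ ((l : Module.Dual k V) u)) := fun u => by
    refine (twistPairing_of τ _ _ _).trans ?_
    rw [pairingBaseChange_tmul, one_mul, one_mul]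
    rfl
  have hσ : ∀ g u, σ g (j u) = j (ρ g u) := fun g u => by
    refine (twistRep_of τ _ g _).trans ?_
    rw [repBaseChange_tmul]
  let Q : Subrepresentation σ :=
    { toSubmodule := ⨅ g, LinearMap.ker (φ ∘ₗ σ g)
      apply_mem_toSubmodule := fun g u hu => by
        rw [Submodule.mem_iInf] at hu ⊢
        intro h
        have := hu (h * g)
        rwa [LinearMap.mem_ker, LinearMap.comp_apply, map_mul, Module.End.mul_apply] at this }
  have hQ : ∀ u, u ∈ Q.toSubmodule ↔ ∀ g, φ (σ g u) = 0 := fun u => by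
    simp [Q, Submodule.mem_iInf]
  rcases hirr.eq_bot_or_eq_top Q with h | h
  · have h1 : j v ∈ Q.toSubmodule := (hQ _).2 fun g => by
      rw [hσ, hφ, hv, map_zero, map_zero]
    rw [h] at h1
    have h2 : j v = j 0 := by
      have h3 : j v = 0 := h1
      rw [h3]
      simp only [j, TensorProduct.tmul_zero]
      exact (Twist.of_sum τ ∅ (fun _ : Unit => (0 : κ ⊗[k] V))).symm
    exact Module.FaithfullyFlat.tensorProduct_mk_injective (A := k) (B := κ) V
      (Twist.of_injective τ h2)
  · refine absurd (Subtype.ext (LinearMap.ext fun u => ?_)) hl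
    have h1 : j u ∈ Q.toSubmodule := by rw [h]; trivial
    have h2 := (hQ _).1 h1 1
    rw [map_one, Module.End.one_apply, hφ, map_eq_zero, map_eq_zero] at h2
    exact h2

/-- Surjectivity of `k → κ` makes every element of the fibres of the form `1 ⊗ v` or `1 ⊗ l`. On the
left, vectors are separated because forms on `V^K` extend to smooth forms. -/
theorem nondegenerate_contragredient (hk : ∀ n : ℕ, n ≠ 0 → IsUnit (n : k))
    {c : Subgroup G → k} (hc : IsVolume c) (hc0 : ∀ K, IsCompactOpen K → c K ≠ 0)
    {ρ : Representation k G V} (hρ : IsSmoothRep ρ) {κ : Type*} [Field κ] [Algebra k κ]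
    (hκ : Function.Surjective (algebraMap k κ)) :
    (pairingBaseChange (W := contragredient ρ) κ (contragredientPairing ρ)).Nondegenerate := by
  have hval : ∀ (v : V) (l : contragredient ρ),
      pairingBaseChange (W := contragredient ρ) κ (contragredientPairing ρ)
      ((1 : κ) ⊗ₜ[k] v) ((1 : κ) ⊗ₜ[k] l) = algebraMap k κ ((l : Module.Dual k V) v) := by
    intro v l
    rw [pairingBaseChange_tmul, one_mul, one_mul]
    rfl
  constructor
  · intro t ht
    obtain ⟨v, rfl⟩ := TensorProduct.mk_surjective k V κ hκ t
    obtain ⟨K, hK, hv⟩ := hρ v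
    have h1 : ∀ φ : Module.Dual k (fixedVectors ρ K), φ ⟨v, hv⟩ = 0 := by
      intro φ
      obtain ⟨l, -, hl⟩ := exists_contragredient_extension hk hc hρ hK (hc0 K hK).isUnit φ
      have h2 := ht ((1 : κ) ⊗ₜ[k] l)
      rw [TensorProduct.mk_apply, hval, map_eq_zero] at h2
      rw [← hl, h2]
    have h3 : v = 0 := congrArg Subtype.val ((Module.forall_dual_apply_eq_zero_iff k _).1 h1)
    rw [h3, map_zero]
  · intro t ht
    obtain ⟨l, rfl⟩ := TensorProduct.mk_surjective k (contragredient ρ) κ hκ t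
    have h3 : l = 0 := Subtype.ext (LinearMap.ext fun v => by
      have h2 := ht ((1 : κ) ⊗ₜ[k] v)
      rw [TensorProduct.mk_apply, hval, map_eq_zero] at h2
      exact h2)
    rw [h3, map_zero]

end Contragredient

/-! ### Rational volumes from the Haar measure. -/

section Volumes

variable {G : Type*} [Group G] [TopologicalSpace G] [ContinuousMul G] [MeasurableSpace G]
  [BorelSpace G]

/-- `K` is the disjoint union of `[K : L]` left translates of `L`, all of the same measure. -/
theorem measureReal_eq_relIndex_mul (μ : Measure G) [μ.IsHaarMeasure] {K L : Subgroup G}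
    (hK : IsCompactOpen K) (hL : IsCompactOpen L) (hLK : L ≤ K) :
    μ.real K = L.relIndex K * μ.real L := by
  have := hK.finite_quotient hL.1
  have := Fintype.ofFinite (K ⧸ L.subgroupOf K)
  let T : K ⧸ L.subgroupOf K → Set G := fun q => (fun g => (q.out : G)⁻¹ * g) ⁻¹' L
  have hT : (K : Set G) = ⋃ q, T q := by
    ext g
    simp only [T, Set.mem_iUnion, Set.mem_preimage, SetLike.mem_coe]
    constructor
    · intro hg
      exact ⟨QuotientGroup.mk ⟨g, hg⟩, Subgroup.mem_subgroupOf.1 (QuotientGroup.eq.1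
        (QuotientGroup.out_eq' (QuotientGroup.mk (⟨g, hg⟩ : K) : K ⧸ L.subgroupOf K)))⟩
    · rintro ⟨q, hq⟩
      exact (K.mul_mem_cancel_left (K.inv_mem q.out.2)).1 (hLK hq)
  have hdisj : Pairwise (Function.onFun Disjoint T) := by
    intro q q' hne
    refine Set.disjoint_left.2 fun g hg hg' => hne ?_
    rw [← QuotientGroup.out_eq' q, ← QuotientGroup.out_eq' q', QuotientGroup.eq,
      Subgroup.mem_subgroupOf]
    have := L.mul_mem hg (L.inv_mem hg')
    simpa [mul_assoc] using this
  have hmeas : ∀ q, MeasurableSet (T q) := fun q =>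
    (hL.1.preimage (continuous_const_mul _)).measurableSet
  have hμT : ∀ q, μ (T q) = μ L := fun q => measure_preimage_mul μ _ _
  have h : μ K = L.relIndex K * μ L := by
    rw [hT, measure_iUnion hdisj hmeas, tsum_fintype, Finset.sum_congr rfl fun q _ => hμT q,
      Finset.sum_const, Finset.card_univ, ← Nat.card_eq_fintype_card, nsmul_eq_mul]
    rfl
  rw [Measure.real, h, ENNReal.toReal_mul, ENNReal.toReal_natCast]
  rfl

theorem exists_rational_volume {μ : Measure G} [μ.IsHaarMeasure] (hμ : IsRationalMeasure μ) :
    ∃ q : Subgroup G → ℚ, IsVolume q ∧ (∀ K, IsCompactOpen K → q K ≠ 0) ∧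
      ∀ K, IsCompactOpen K → (q K : ℝ) = μ.real K := by
  classical
  choose! q hq using hμ
  refine ⟨q, fun K L hK hL hLK => ?_, fun K hK h0 => ?_, hq⟩
  · have h := measureReal_eq_relIndex_mul μ hK hL hLK
    rw [← hq K hK, ← hq L hL] at h
    exact_mod_cast h
  · have h := hq K hK
    rw [h0, Rat.cast_zero] at h
    have hpos : 0 < μ.real K := ENNReal.toReal_pos (hK.1.measure_pos μ ⟨1, K.one_mem⟩).ne'
      hK.2.measure_lt_top.ne
    exact hpos.ne h

end Volumes

/-! ### The two implications. -/

section MainResults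

variable {G : Type*} [Group G] [TopologicalSpace G] [ContinuousMul G] [MeasurableSpace G]
  [BorelSpace G] {Y : Type*} [TopologicalSpace Y] [MeasurableSpace Y] [MulAction Gᵐᵒᵖ Y]
  {ν : Measure Y} (P : PlancherelDecomposition.{w} G ν) (y₀ : Y) {μ : Measure G} [μ.IsHaarMeasure]
  (hμ : IsRationalMeasure μ) {E : Type u} [Field E] [CharZero E]

include hμ

/-- Rationality of local periods implies rationality of spherical characters. -/
theorem PeriodRationality.characterRationality {H : Subgroup G} {S : Set (PrimeSpectrum E)}
    {V : Type u} [AddCommGroup V] [Module E V] {ρ : Representation E G V}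
    (hρ : IsAdmissibleFamily ρ) (hgood : ∀ x ∈ S, (goodEmbeddings P x ρ).Nonempty)
    (hP : PeriodRationality P y₀ H S ρ) : CharacterRationality P y₀ μ S ρ := by
  intro x hx
  obtain ⟨q, hq, hq0, hqμ⟩ := exists_rational_volume hμ
  have hE : ∀ n : ℕ, n ≠ 0 → IsUnit (n : E) := fun n hn => by simpa using hn
  have hqE : IsVolume fun K : Subgroup G => (q K : E) := isVolume_ratCast hq E
  have hqE0 : ∀ K, IsCompactOpen K → (q K : E) ≠ 0 := fun K hK => Rat.cast_ne_zero.2 (hq0 K hK)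
  -- The only prime of a field is `0`, which is maximal, so the residue field is a quotient of `E`.
  have hsurj : ∀ x : PrimeSpectrum E, Function.Surjective (algebraMap E (resField x)) := by
    intro x
    have : x.asIdeal.IsMaximal := by
      rw [Ideal.eq_bot_of_prime x.asIdeal]
      exact Ideal.bot_isMaximal
    exact Ideal.algebraMap_residueField_surjective x.asIdeal
  have : CharZero (resField x) := charZero_of_injective_ringHom (algebraMap E (resField x)).injective
  obtain ⟨τ, hτ⟩ := hgood x hx
  have hfam : IsAdmissibleFamily (contragredientRep ρ) :=
    { smooth := hρ.smooth.contragredientRep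
      admissible := hρ.admissible.contragredientRep hE hqE hqE0 hρ.smooth
      finitelyGenerated := contragredient_finite hE hρ.smooth hρ.admissible
        (separating_of_isIrreducible_twist τ hτ.1)
      torsionFree := inferInstance }
  have hdual : IsDualFamily (W := contragredient ρ) S ρ (contragredientRep ρ)
      (contragredientPairing ρ) :=
    { isAdmissibleFamily := hfam
      invariant := isInvariantPairing_contragredient ρ
      nondegenerate := fun y _ =>
        nondegenerate_contragredient hE hqE hqE0 hρ.smooth (hsurj y) }
  obtain ⟨Zx, hZx, -⟩ := hP (contragredient ρ) (contragredientRep ρ) (contragredientPairing ρ)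
    hdual x hx
  obtain ⟨J, hJ, -⟩ := exists_isCharacterAt (W := contragredient ρ) P y₀ hE hq hq0 hqμ hρ.smooth
    hρ.admissible hfam.smooth hdual.invariant x (hdual.nondegenerate x hx) hZx
  exact ⟨J, hJ, fun J' hJ' => hJ'.unique P y₀ ⟨τ, hτ⟩ hJ⟩

/-- Meromorphy of local periods implies meromorphy of spherical characters. -/
theorem PeriodMeromorphy.characterMeromorphy {H : Subgroup G} {R : Type u} [CommRing R]
    [Algebra E R] [IsNoetherianRing R] [IsReduced R] {S : Set (PrimeSpectrum R)} (hS : Dense S)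
    {V W : Type u} [AddCommGroup V] [Module R V] [AddCommGroup W] [Module R W]
    {ρ : Representation R G V} {ρ' : Representation R G W} {B : V →ₗ[R] W →ₗ[R] R}
    (hρ : IsAdmissibleFamily ρ) (hB : IsDualFamily S ρ ρ' B)
    (hP : PeriodMeromorphy P y₀ H S ρ ρ' B) : CharacterMeromorphy P y₀ E μ S ρ := by
  classical
  obtain ⟨q, hq, hq0, hqμ⟩ := exists_rational_volume hμ
  have hR : ∀ n : ℕ, n ≠ 0 → IsUnit (n : R) := fun n hn => by
    have h : IsUnit (n : E) := by simpa using hn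
    simpa using h.map (algebraMap E R)
  have hchar : ∀ x : PrimeSpectrum R, CharZero (resField x) := fun x =>
    charZero_of_injective_ringHom ((algebraMap R (resField x)).comp (algebraMap E R)).injective
  obtain ⟨U, hU, Z, -, hZ⟩ := hP
  choose! Zx hper hZx using hZ
  choose! J hJ hJt using fun (x : PrimeSpectrum R) (hx : x ∈ S) =>
    exists_isCharacterAt P y₀ hR hq hq0 hqμ hρ.smooth hρ.admissible hB.isAdmissibleFamily.smooth
      hB.invariant x (hB.nondegenerate x hx) (hper x hx)
  refine ⟨J, hJ, fun f => ?_⟩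
  -- Since `ℚ` maps to `R`, the rational volumes become units of `R`, so Hecke operators and
  -- projections exist over the whole family.
  let ψ : ℚ →+* R := (algebraMap E R).comp (Rat.castHom E)
  refine existsUnique_meromorphic hS _ fun x hx =>
    exists_local_character hR (hq.map ψ) (fun K hK => (hq0 K hK).isUnit.map ψ) hρ.smooth
      hρ.admissible hB.isAdmissibleFamily.smooth hB.invariant hU Z Zx hZx
      (fun x _ => isVolume_ratCast hq (resField x))
      (fun x _ K _ => ?_) hJt (heckeSpace.map (algebraMap E R) f) hx (hB.nondegenerate x hx)
  exact (map_ratCast (((algebraMap R (resField x)).comp (algebraMap E R)).comp (Rat.castHom E))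
    (q K)).symm.trans rfl

end MainResults

end

theorem mainTheorem2
    {F : Type*} [Field F] [CharZero F] [ValuativeRel F] [TopologicalSpace F]
    [IsNonarchimedeanLocalField F]
    (X : SphericalPair F)
    (μ : MeasureTheory.Measure X.GF) [μ.IsHaarMeasure] (hμ : IsRationalMeasure μ)
    (ν : MeasureTheory.Measure X.YF) [MeasureTheory.IsFiniteMeasureOnCompacts ν]
    [ν.IsOpenPosMeasure]
    (hν : ∀ g : X.GF, MeasureTheory.MeasurePreserving (fun y : X.YF => y <• g) ν ν)
    (P : PlancherelDecomposition.{w} X.GF ν)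
    {E : Type u} [Field E] (hE : Nonempty (E →+* ℂ)) :
    (∀ (S : Set (PrimeSpectrum E)), (∀ x ∈ S, IsClosed {x}) → Dense S →
      ∀ (V : Type u) [AddCommGroup V] [Module E V] (ρ : Representation E X.GF V),
      IsAdmissibleFamily ρ → (∀ x ∈ S, (goodEmbeddings P x ρ).Nonempty) →
      PeriodRationality P X.basePoint X.HF S ρ →
      CharacterRationality P X.basePoint μ S ρ) ∧
    (∀ (R : Type u) [CommRing R] [Algebra E R] [IsNoetherianRing R] [IsReduced R]
      (S : Set (PrimeSpectrum R)), (∀ x ∈ S, IsClosed {x}) → Dense S →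
      ∀ (V W : Type u) [AddCommGroup V] [Module R V] [AddCommGroup W] [Module R W]
      (ρ : Representation R X.GF V) (ρ' : Representation R X.GF W) (B : V →ₗ[R] W →ₗ[R] R),
      IsAdmissibleFamily ρ → (∀ x ∈ S, (goodEmbeddings P x ρ).Nonempty) →
      IsDualFamily S ρ ρ' B →
      HasLocallyConstantRanks S ρ →
      PeriodMeromorphy P X.basePoint X.HF S ρ ρ' B →
      CharacterMeromorphy P X.basePoint E μ S ρ) := by
  obtain ⟨ι⟩ := hE
  have : CharZero E := ι.charZero
  exact ⟨fun S _ _ V _ _ ρ hρ hgood hP => hP.characterRationality P X.basePoint hμ hρ hgood,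
    fun R _ _ _ _ S _ hS V W _ _ _ _ ρ ρ' B hρ _ hB _ hP =>
      hP.characterMeromorphy P X.basePoint hμ hS hρ hB⟩
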